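/- Let $\mathcal T_h$ be a conforming tetrahedral triangulation of a bounded polyhedral domain $\Omega\subset\mathbb R^3$, shape regular with constant $\sigma$ (each $K\in\mathcal T_h$ contains a ball of diameter $\rho_K$ with $h_K=\operatorname{diam}K\le\sigma\rho_K$). Let $\beta$ be a positive constant $\beta_K$ on each $K\in\mathcal T_h$. Let $\boldsymbol u_h$ be in the lowest order Nédélec space, that is, $\boldsymbol u_h\in \boldsymbol H(\mathbf{curl};\Omega)$ and on each $K$, $\boldsymbol u_h(\boldsymbol x)=\boldsymbol a_K+\boldsymbol b_K\times\boldsymbol x$; in particular, $\boldsymbol u_h$ may be the Nédélec finite element solution of $\nabla\times(\mu^{-1}\nabla\times\boldsymbol u)+\beta\boldsymbol u=\boldsymbol f$ in $\Omega$, $\boldsymbol u\times\boldsymbol n=\boldsymbol g$ on $\partial\Omega$. Put $\boldsymbol\tau_h=\beta\boldsymbol u_h$. Fix a unit normal $\boldsymbol n_F$ on each face $F$, outward to $\Omega$ if $F\subset\partial\Omega$. Let $K_-$ and (if $F$ is interior) $K_+$ be the elements sharing $F$ for which $\boldsymbol n_F$ is outward and inward, respectively, and let $v^\mp$ be the traces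 on $F$ of $v|_{K_\mp}$; on a boundary face $v$ is extended by zero, so $v^+=0$. Write $[\![v]\!]_F=v^--v^+$, $\beta_F=(\beta^-+\beta^+)/2$ and $h_F=\operatorname{diam}F$. On interior faces let $$\kappa_F^-=\frac{\beta_{K_+}^{1/2}}{\beta_{K_-}^{1/2}+\beta_{K_+}^{1/2}},\qquad \kappa_F^+=1-\kappa_F^-,$$ and on boundary faces let $\kappa_F^-=0$, $\kappa_F^+=1$. Put $\boldsymbol\tau_{h,F}=\kappa_F^-\boldsymbol\tau_h^-+\kappa_F^+\boldsymbol\tau_h^+$ and $$\boldsymbol\tau_h^*=\sum_F\sum_{\boldsymbol z\in\mathcal N_h(F)}\Big(\frac1{|F|}\int_F(\boldsymbol\tau_{h,F}\cdot\boldsymbol n_F)\lambda_{\boldsymbol z}\,dS\Big)\boldsymbol\psi_{F,\boldsymbol z},$$ where the sum is over all faces $F$ and their vertices $\boldsymbol z$, $\lambda_{\boldsymbol z}$ are the barycentric coordinates, and $\boldsymbol\psi_{F,\boldsymbol z}$ is the Brezzi–Douglas–Marini basis function that vanishes on the elements not having $F$ as a face and that on an element $K$ with vertex $\boldsymbol z_i$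 opposite to $F=\mathrm{conv}(\boldsymbol z_j,\boldsymbol z_k,\boldsymbol z_l)$, $\boldsymbol z=\boldsymbol z_j$, is $$\boldsymbol\psi_{F,\boldsymbol z_j}=9\frac{\lambda_j\boldsymbol t_{ij}}{\boldsymbol n_F\cdot\boldsymbol t_{ij}}-3\frac{\lambda_k\boldsymbol t_{ik}}{\boldsymbol n_F\cdot\boldsymbol t_{ik}}-3\frac{\lambda_l\boldsymbol t_{il}}{\boldsymbol n_F\cdot\boldsymbol t_{il}},\qquad \boldsymbol t_{im}=\frac{\boldsymbol z_m-\boldsymbol z_i}{|\boldsymbol z_m-\boldsymbol z_i|}.$$ Define $\eta_{K,0}=\|\beta^{-1/2}\boldsymbol\tau_h^*-\beta^{1/2}\boldsymbol u_h\|_{\boldsymbol L^2(K)}$. Then there is a constant $c>0$, depending only on $\sigma$ (in particular independent of $\beta$ and its jumps), such that for every $K\in\mathcal T_h$ $$c\,\eta_{K,0}\le\sum_{F\subset\partial K}h_F^{1/2}\,\big\|\beta_F^{-1/2}[\![\beta\boldsymbol u_h\cdot\boldsymbol n_F]\!]_F\big\|_{L^2(F)},$$ where the sum is over the four faces $F$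 of $K$. The same holds, with the same $c$, if instead $\kappa_F^-=1$, $\kappa_F^+=0$ on boundary faces. -/

import Mathlib

open MeasureTheory
open scoped ContDiff

noncomputable section

/-- Euclidean three-space. -/
abbrev E3 : Type := EuclideanSpace ℝ (Fin 3)

/-- The vector product on `E3`. -/
def cross (a b : E3) : E3 := WithLp.toLp 2 (crossProduct a.ofLp b.ofLp)

/-- The partial derivative `∂ᵢ φⱼ (x)` of a vector field. -/
def pderiv3 (φ : E3 → E3) (i j : Fin 3) (x : E3) : ℝ :=
  (fderiv ℝ φ x (EuclideanSpace.single i 1)) j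

/-- The classical curl of a (differentiable) vector field. -/
def curl (φ : E3 → E3) (x : E3) : E3 :=
  !₂[pderiv3 φ 1 2 x - pderiv3 φ 2 1 x,
     pderiv3 φ 2 0 x - pderiv3 φ 0 2 x,
     pderiv3 φ 0 1 x - pderiv3 φ 1 0 x]

/-- `v ∈ H(curl; Ω)`: `v` is square integrable on `Ω` and has a square integrable weak curl `w`. -/
def MemHcurl (Ω : Set E3) (v : E3 → E3) : Prop :=
  MemLp v 2 (volume.restrict Ω) ∧
    ∃ w : E3 → E3, MemLp w 2 (volume.restrict Ω) ∧
      ∀ φ : E3 → E3, ContDiff ℝ ∞ φ → HasCompactSupport φ → tsupport φ ⊆ Ω →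
        ∫ x in Ω, inner ℝ (v x) (curl φ x) = ∫ x in Ω, inner ℝ (w x) (φ x)

open Classical in
/-- The barycentric coordinate `λ_z (x)` of the point `x` with respect to the vertex `z` of the
simplex with (affinely independent) vertex set `S`; it is zero if `x` is not in the affine span
of `S` or `z` is not in `S`. For a face `S` it is the restriction to the affine span of the face
of the barycentric coordinate of any simplex having that face and having `z` as a vertex. -/
def baryCoord (S : Finset E3) (z x : E3) : ℝ :=
  if h : ∃ w : E3 → ℝ, (∑ y ∈ S, w y = 1) ∧ (∑ y ∈ S, w y • y = x) then
    if z ∈ S then h.choose z else 0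
  else 0

/-- The `L²(S; m)` norm of a scalar or vector field. -/
def l2Norm {V : Type*} [NormedAddCommGroup V] (m : Measure E3) (S : Set E3) (f : E3 → V) : ℝ :=
  (eLpNorm f 2 (m.restrict S)).toReal

/-- The two-dimensional surface measure in `E3` (the two-dimensional Hausdorff measure, normalized
so that it is the area on planes). -/
def surf : Measure E3 := Measure.euclideanHausdorffMeasure 2

/-- The closed simplex with a given vertex set. -/
def hull (S : Finset E3) : Set E3 := convexHull ℝ (S : Set E3)

/-- A conforming tetrahedral triangulation. A cell is given by its set of four vertices. -/
structure TetMesh where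
  /-- the tetrahedra `K ∈ T_h` -/
  cells : Finset (Finset E3)
  card_eq : ∀ K ∈ cells, K.card = 4
  indep : ∀ K ∈ cells, AffineIndependent ℝ ((↑) : K → E3)
  /-- two tetrahedra meet in the simplex spanned by their common vertices (or not at all) -/
  inter : ∀ K ∈ cells, ∀ L ∈ cells, hull K ∩ hull L = convexHull ℝ ((K : Set E3) ∩ (L : Set E3))

/-- The faces of the tetrahedron `K`, as sets of three vertices. -/
def facesOf (K : Finset E3) : Finset (Finset E3) := K.powersetCard 3

/-- The unit normal vector `m` of the face `F` of `K` is outward for `K`: the vertex of `K` that is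
not in `F` lies strictly behind the plane of `F`. -/
def OutwardFor (m : E3) (F K : Finset E3) : Prop :=
  ∀ y ∈ F, ∀ z ∈ K, z ∉ F → inner ℝ m (z - y) < 0

/-- The unit normal vector `m` of the face `F` of `K` is inward for `K`. -/
def InwardFor (m : E3) (F K : Finset E3) : Prop :=
  ∀ y ∈ F, ∀ z ∈ K, z ∉ F → 0 < inner ℝ m (z - y)

/-- The vertex of `K` opposite to its face `F`. -/
def oppVertex (K F : Finset E3) : E3 :=
  open Classical in if h : ∃ i ∈ K, i ∉ F then h.choose else 0

/-- The unit vector of the edge from `i` to `j`. -/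
def edgeTangent (i j : E3) : E3 := ‖j - i‖⁻¹ • (j - i)

open Classical in
/-- The restriction to the cell `K` of the nodal basis function `ψ_{F,z}` of the lowest order
Brezzi-Douglas-Marini space, for a face `F` of `K`, a vertex `z` of `F` and the unit normal `m`
assigned to `F`. With `i` the vertex opposite to `F` and `F = {z, k, l}` it is
`9 λ_z t_{iz} / (m · t_{iz}) - 3 λ_k t_{ik} / (m · t_{ik}) - 3 λ_l t_{il} / (m · t_{il})`. Using the
globally fixed normal `m` (instead of the outward normal of `K`) includes the sign that makes the
normal component of `ψ_{F,z}` continuous across `F`. -/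
def bdmBasis (m : E3) (K F : Finset E3) (z x : E3) : E3 :=
  ∑ w ∈ F, ((if w = z then 9 else -3) * baryCoord K w x /
      inner ℝ m (edgeTangent (oppVertex K F) w)) • edgeTangent (oppVertex K F) w

namespace TetMesh

variable (T : TetMesh)

/-- The open domain that is triangulated. -/
def domain : Set E3 := interior (⋃ K ∈ T.cells, hull K)

/-- Shape regularity with constant `σ`: the diameter of every cell `K` is at most `σ` times the
diameter of some ball inscribed in `K`. -/
def ShapeRegular (σ : ℝ) : Prop :=
  ∀ K ∈ T.cells, ∃ (p : E3) (r : ℝ), 0 < r ∧ Metric.closedBall p r ⊆ hull K ∧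
    Metric.diam (hull K) ≤ σ * (2 * r)

/-- `L` is the cell `K₋` of the face `F`, for which the fixed normal `n F` is outward. -/
def IsMinus (n : Finset E3 → E3) (F L : Finset E3) : Prop :=
  L ∈ T.cells ∧ F ∈ facesOf L ∧ OutwardFor (n F) F L

/-- `L` is the cell `K₊` of the face `F`, for which the fixed normal `n F` is inward. -/
def IsPlus (n : Finset E3 → E3) (F L : Finset E3) : Prop :=
  L ∈ T.cells ∧ F ∈ facesOf L ∧ InwardFor (n F) F L

/-- `n` assigns to each face a fixed unit normal vector. Every face has a cell `K₋`: on a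
boundary face (a face of just one cell) the normal points out of the domain. -/
def IsFaceNormal (n : Finset E3 → E3) : Prop :=
  ∀ K ∈ T.cells, ∀ F ∈ facesOf K,
    ‖n F‖ = 1 ∧ (∀ y ∈ F, ∀ z ∈ F, inner ℝ (n F) (y - z) = 0) ∧ ∃ L, T.IsMinus n F L

/-- The value from the side of `K₋` on the face `F` of a quantity `v` given cell by cell. -/
def minusVal {V : Type*} [Zero V] (n : Finset E3 → E3) (v : Finset E3 → V) (F : Finset E3) : V :=
  open Classical in if h : ∃ L, T.IsMinus n F L then v h.choose else 0

/-- The value from the side of `K₊` on the face `F` of a quantity `v` given cell by cell,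
extended by zero outside of the domain if `F` is a boundary face. -/
def plusVal {V : Type*} [Zero V] (n : Finset E3 → E3) (v : Finset E3 → V) (F : Finset E3) : V :=
  open Classical in if h : ∃ L, T.IsPlus n F L then v h.choose else 0

open Classical in
/-- The vector field on the domain that equals `v K` in the interior of each cell `K`. -/
def glue (v : Finset E3 → E3 → E3) (x : E3) : E3 :=
  ∑ K ∈ T.cells, Set.indicator (interior (hull K)) (v K) x

/-- `v` belongs to the lowest order Nédélec space: the restriction `v K` to each cell `K` is of the
form `a + b × x`, and the vector field that is composed of these restrictions is in `H(curl)`. -/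
def MemND0 (v : Finset E3 → E3 → E3) : Prop :=
  (∀ K ∈ T.cells, ∃ a b : E3, ∀ x, v K x = a + cross b x) ∧ MemHcurl T.domain (T.glue v)

section recovery

/- `n` are the face normals, `β` the coefficient on each cell, `u` the restriction of `u_h` to each
cell, and `θ` is the weight of the interior trace on boundary faces. -/
variable (θ : ℝ) (n : Finset E3 → E3) (β : Finset E3 → ℝ) (u : Finset E3 → E3 → E3)

/-- `τ_h = β u_h`. -/
def tau (K : Finset E3) (x : E3) : E3 := β K • u K x

open Classical in
/-- The weight `κ_F⁻`, namely `√β₊ / (√β₋ + √β₊)` on an interior face and `θ` on a boundary face. -/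
def kappaMinus (F : Finset E3) : ℝ :=
  if ∃ L, T.IsPlus n F L then
    √(T.plusVal n β F) / (√(T.minusVal n β F) + √(T.plusVal n β F))
  else θ

/-- The weight `κ_F⁺ = 1 - κ_F⁻`. -/
def kappaPlus (F : Finset E3) : ℝ := 1 - T.kappaMinus θ n β F

/-- The weighted average `τ_{h,F} = κ_F⁻ τ_h⁻ + κ_F⁺ τ_h⁺` on the face `F`. -/
def tauFace (F : Finset E3) (x : E3) : E3 :=
  T.kappaMinus θ n β F • T.minusVal n (tau β u) F x +
    T.kappaPlus θ n β F • T.plusVal n (tau β u) F x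

/-- The degree of freedom `|F|⁻¹ ∫_F (τ_{h,F} · n_F) λ_z dS` of the recovered flux. -/
def recoveredDof (F : Finset E3) (z : E3) : ℝ :=
  (surf.real (hull F))⁻¹ *
    ∫ x in hull F, inner ℝ (T.tauFace θ n β u F x) (n F) * baryCoord F z x ∂surf

/-- The restriction to the cell `K` of the recovered flux `τ_h^*`; the basis functions of the faces
that are not faces of `K` vanish in `K`. -/
def tauStar (K : Finset E3) (x : E3) : E3 :=
  ∑ F ∈ facesOf K, ∑ z ∈ F, T.recoveredDof θ n β u F z • bdmBasis (n F) K F z x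

/-- The recovery indicator `η_{K,0}`, the `L²(K)` norm of `β^{-1/2} τ_h^* - β^{1/2} u_h`. -/
def eta0 (K : Finset E3) : ℝ :=
  l2Norm volume (hull K) fun x =>
    (√(β K))⁻¹ • T.tauStar θ n β u K x - √(β K) • u K x

/-- The jump `[[β u_h · n]]_F = (β u_h · n_F)⁻ - (β u_h · n_F)⁺`. -/
def normalJump (F : Finset E3) (x : E3) : ℝ :=
  inner ℝ (T.minusVal n (tau β u) F x) (n F) - inner ℝ (T.plusVal n (tau β u) F x) (n F)

/-- The arithmetic average `β_F = (β₋ + β₊) / 2` of the coefficient on the face `F`, where `β` is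
extended by zero outside of the domain. -/
def betaFace (F : Finset E3) : ℝ := (T.minusVal n β F + T.plusVal n β F) / 2

/-- The residual-type term `h_F^{1/2} ‖β_F^{-1/2} [[β u_h · n]]_F‖_{L²(F)}` of the face `F`. -/
def faceJumpTerm (F : Finset E3) : ℝ :=
  √(Metric.diam (hull F)) *
    l2Norm surf (hull F) fun x => (√(T.betaFace n β F))⁻¹ * T.normalJump n β u F x

end recovery

end TetMesh

end

/-! On a cell `K` the flux `τ_h = β_K u_h` is affine, and the local Brezzi-Douglas-Marini
interpolation reproduces affine fields exactly (`bdm_reproduces_affine`). Hence `τ_h^* - τ_h` on `K`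
is a combination of the twelve basis functions of `K`, whose coefficients are the face moments of
`(τ_{h,F} - τ_h|_K) · n_F`.

Because the two weights add up to one, this normal difference is `δ` times the jump: `δ = -κ_F⁺` if
`K = K₋`, and `δ = κ_F⁻` if `K = K₊`. On an interior face the choice of weights gives, from either
side, `β_K^{-1/2} |δ| = 1 / (√β₋ + √β₊) ≤ β_F^{-1/2}`; this is where robustness in `β` comes from.
On a boundary face `|δ| ≤ 1` and `β_F = β_K / 2`, so both boundary weights work
(`exists_tauFace_sub_eq`).

Reproduction rests on two dualities. The moment of an affine `g` against `λ_z` on a triangle is `(g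
z + ∑ g) / 12`, and the matrix `(I + 11ᵀ) / 12` has the inverse with `9` on the diagonal and `-3`
off it, which are the coefficients of the basis functions. So on each face the combination restores
the nodal normal components, and at a vertex the three normal components determine the vector
(`sum_dual_basis`).

The rest is scaling: basis functions are bounded by a multiple of `σ`, Cauchy-Schwarz bounds a
moment of the jump by `|F|^{-1/2}` times its norm, and shape regularity gives `|K| / |F| ≤ C h_F`.
-/

/-! ### Barycentric coordinates. -/

/-- `baryCoord` takes its weights by choice; affine independence makes them unique on `S`, so any
admissible weights compute it. -/
theorem baryCoord_eq {S : Finset E3} (hS : AffineIndependent ℝ ((↑) : S → E3)) {w : E3 → ℝ}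
    {x : E3} (h1 : ∑ y ∈ S, w y = 1) (hx : ∑ y ∈ S, w y • y = x) {z : E3} (hz : z ∈ S) :
    baryCoord S z x = w z := by
  have h : ∃ w : E3 → ℝ, (∑ y ∈ S, w y = 1) ∧ (∑ y ∈ S, w y • y = x) := ⟨w, h1, hx⟩
  rw [baryCoord, dif_pos h, if_pos hz]
  obtain ⟨h1', hx'⟩ := h.choose_spec
  have key := affineIndependent_iff.1 hS Finset.univ (fun y => h.choose y - w y)
    (by rw [Finset.univ_eq_attach, Finset.sum_attach S (fun y => h.choose y - w y),
      Finset.sum_sub_distrib, h1, h1', sub_self])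
    (by rw [Finset.univ_eq_attach, Finset.sum_attach S (fun y => (h.choose y - w y) • y)]
        simp_rw [sub_smul]
        rw [Finset.sum_sub_distrib, hx, hx', sub_self])
    ⟨z, hz⟩ (Finset.mem_univ _)
  exact sub_eq_zero.1 key

theorem exists_baryCoord {K : Finset E3} (hc : K.card = 4)
    (hK : AffineIndependent ℝ ((↑) : K → E3)) (x : E3) :
    ∃ w : E3 → ℝ, (∑ y ∈ K, w y = 1) ∧ (∑ y ∈ K, w y • y = x) := by
  classical
  have ht : affineSpan ℝ (Set.range ((↑) : K → E3)) = ⊤ := by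
    rw [hK.affineSpan_eq_top_iff_card_eq_finrank_add_one]
    simp [hc]
  obtain ⟨w, hw, hx⟩ := eq_affineCombination_of_mem_affineSpan_of_fintype
    (show x ∈ affineSpan ℝ (Set.range ((↑) : K → E3)) by rw [ht]; trivial)
  rw [Finset.affineCombination_eq_linear_combination _ _ _ hw] at hx
  refine ⟨fun y => if h : y ∈ K then w ⟨y, h⟩ else 0, ?_, ?_⟩
  · rw [← Finset.sum_attach, ← hw, Finset.univ_eq_attach]
    exact Finset.sum_congr rfl fun y _ => by simp
  · rw [← Finset.sum_attach, hx, Finset.univ_eq_attach]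
    exact Finset.sum_congr rfl fun y _ => by simp

theorem sum_baryCoord {K : Finset E3} (hc : K.card = 4)
    (hK : AffineIndependent ℝ ((↑) : K → E3)) (x : E3) : ∑ y ∈ K, baryCoord K y x = 1 := by
  obtain ⟨w, h1, hx⟩ := exists_baryCoord hc hK x
  rw [Finset.sum_congr rfl fun y hy => baryCoord_eq hK h1 hx hy, h1]

theorem sum_baryCoord_smul {K : Finset E3} (hc : K.card = 4)
    (hK : AffineIndependent ℝ ((↑) : K → E3)) (x : E3) : ∑ y ∈ K, baryCoord K y x • y = x := by
  obtain ⟨w, h1, hx⟩ := exists_baryCoord hc hK x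
  rw [Finset.sum_congr rfl fun y hy => by rw [baryCoord_eq hK h1 hx hy], hx]

theorem abs_baryCoord_le_one {S : Finset E3} (hS : AffineIndependent ℝ ((↑) : S → E3)) {x z : E3}
    (hx : x ∈ hull S) (hz : z ∈ S) : |baryCoord S z x| ≤ 1 := by
  obtain ⟨w, h0, h1, hw⟩ := Finset.mem_convexHull'.1 hx
  rw [baryCoord_eq hS h1 hw hz, abs_of_nonneg (h0 z hz), ← h1]
  exact Finset.single_le_sum h0 hz

theorem AffineMap.map_sum_smul {ι V W : Type*} [AddCommGroup V] [Module ℝ V] [AddCommGroup W]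
    [Module ℝ W] (A : V →ᵃ[ℝ] W) (S : Finset ι) (w : ι → ℝ) (p : ι → V) (h1 : ∑ y ∈ S, w y = 1) :
    A (∑ y ∈ S, w y • p y) = ∑ y ∈ S, w y • A (p y) := by
  have hA : ∀ v, A v = A.linear v + A 0 := fun v => congrFun A.decomp v
  have h2 : ∑ y ∈ S, w y • A (p y) = ∑ y ∈ S, (w y • A.linear (p y) + w y • A 0) :=
    Finset.sum_congr rfl fun y _ => by rw [hA (p y), smul_add]
  rw [hA, h2, Finset.sum_add_distrib, ← Finset.sum_smul, h1, one_smul, map_sum]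
  simp only [map_smul]

/-! ### The Brezzi-Douglas-Marini basis on one cell. -/

open Classical in
theorem sum_facesOf {M : Type*} [AddCommMonoid M] {K : Finset E3} (hc : K.card = 4)
    (f : Finset E3 → M) : ∑ F ∈ facesOf K, f F = ∑ i ∈ K, f (K.erase i) := by
  symm
  refine Finset.sum_bij (fun i _ => K.erase i) ?_ ?_ ?_ (fun _ _ => rfl)
  · intro i hi
    rw [facesOf, Finset.mem_powersetCard]
    exact ⟨Finset.erase_subset _ _, by rw [Finset.card_erase_of_mem hi, hc]⟩
  · intro i hi j hj h
    exact (Finset.erase_inj K hi).1 h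
  · intro F hF
    rw [facesOf, Finset.mem_powersetCard] at hF
    have : (K \ F).card = 1 := by rw [Finset.card_sdiff_of_subset hF.1]; omega
    obtain ⟨i, hi⟩ := Finset.card_eq_one.1 this
    have hi' : i ∈ K \ F := by rw [hi]; simp
    refine ⟨i, (Finset.mem_sdiff.1 hi').1, ?_⟩
    rw [Finset.erase_eq, ← hi, Finset.sdiff_sdiff_eq_self hF.1]

open Classical in
theorem oppVertex_erase {K : Finset E3} {i : E3} (hi : i ∈ K) : oppVertex K (K.erase i) = i := by
  have h : ∃ j ∈ K, j ∉ K.erase i := ⟨i, hi, by simp⟩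
  rw [oppVertex, dif_pos h]
  have := h.choose_spec
  by_contra hne
  exact this.2 (Finset.mem_erase.2 ⟨hne, this.1⟩)

/-- `m i` is a normal vector of the face of `K` opposite to `i`. -/
structure IsNormalFamily (K : Finset E3) (m : E3 → E3) : Prop where
  perp : ∀ i ∈ K, ∀ y ∈ K, ∀ z ∈ K, y ≠ i → z ≠ i → inner ℝ (m i) (y - z) = 0
  ne_zero : ∀ i ∈ K, ∀ y ∈ K, y ≠ i → inner ℝ (m i) (y - i) ≠ 0

open Classical in
-- The edges `w - i` and the normals `m i` of the three faces through `w` are biorthogonal: for `k ≠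
-- i` both `w` and `i` lie on the face opposite to `k`.
theorem sum_dual_basis {K : Finset E3} (hc : K.card = 4)
    (hK : AffineIndependent ℝ ((↑) : K → E3)) {m : E3 → E3} (hm : IsNormalFamily K m)
    {w : E3} (hw : w ∈ K) (v : E3) :
    ∑ i ∈ K.erase w, (inner ℝ v (m i) / inner ℝ (m i) (w - i)) • (w - i) = v := by
  set s := ∑ i ∈ K.erase w, (inner ℝ v (m i) / inner ℝ (m i) (w - i)) • (w - i) with hs
  have hperp : ∀ k ∈ K, k ≠ w → inner ℝ (m k) (s - v) = 0 := by
    intro k hk hkw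
    rw [inner_sub_right, hs, inner_sum, Finset.sum_eq_single_of_mem k (Finset.mem_erase.2 ⟨hkw, hk⟩)]
    · rw [inner_smul_right, div_mul_cancel₀ _ (hm.ne_zero k hk w hw hkw.symm), real_inner_comm,
        sub_self]
    · intro i hi hik
      obtain ⟨hiw, hi⟩ := Finset.mem_erase.1 hi
      rw [inner_smul_right, hm.perp k hk w hw i hi hkw.symm hik, mul_zero]
  -- The defect `s - v` is orthogonal to three normals. Written in the edges `y - w`, each of its
  -- coefficients is detected by one of these normals, hence vanishes.
  obtain ⟨c, h1, hx⟩ := exists_baryCoord hc hK (w + (s - v))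
  have hd : s - v = ∑ y ∈ K, c y • (y - w) := by
    simp_rw [smul_sub]
    rw [Finset.sum_sub_distrib, ← Finset.sum_smul, h1, hx]; simp
  have hz : ∀ y ∈ K, c y • (y - w) = 0 := by
    intro k hk
    by_cases hkw : k = w
    · simp [hkw]
    have := hperp k hk hkw
    rw [hd, inner_sum, Finset.sum_eq_single_of_mem k hk, inner_smul_right] at this
    · have h2 := hm.ne_zero k hk w hw (Ne.symm hkw)
      rw [← neg_sub, inner_neg_right, neg_ne_zero] at h2
      rw [(mul_eq_zero.1 this).resolve_right h2, zero_smul]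
    · intro i hi hik
      rw [inner_smul_right, hm.perp k hk i hi w hw hik (Ne.symm hkw), mul_zero]
  rw [Finset.sum_eq_zero hz] at hd
  exact sub_eq_zero.1 hd

theorem edgeTangent_div (a : ℝ) (m : E3) {i w : E3} (h : w ≠ i) :
    (a / inner ℝ m (edgeTangent i w)) • edgeTangent i w =
      (a / inner ℝ m (w - i)) • (w - i) := by
  have h0 : ‖w - i‖ ≠ 0 := norm_ne_zero_iff.2 (sub_ne_zero.2 h)
  rw [edgeTangent, inner_smul_right, smul_smul]
  congr 1
  by_cases h2 : inner ℝ m (w - i) = 0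
  · simp [h2]
  · field_simp

open Classical in
-- The coefficients on the left are the moments of an affine function with nodal values `g`; the
-- entries `9` and `-3` invert the moment matrix, leaving the nodal values themselves.
theorem sum_smul_bdmBasis {K : Finset E3} {i : E3} (hi : i ∈ K) (hF : (K.erase i).card = 3)
    (m : E3) (g : E3 → ℝ) (x : E3) :
    ∑ z ∈ K.erase i, ((g z + ∑ y ∈ K.erase i, g y) / 12) • bdmBasis m K (K.erase i) z x =
      ∑ w ∈ K.erase i, baryCoord K w x • ((g w / inner ℝ m (w - i)) • (w - i)) := by
  simp_rw [bdmBasis, oppVertex_erase hi, Finset.smul_sum]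
  rw [Finset.sum_comm]
  refine Finset.sum_congr rfl fun w hw => ?_
  have hwi : w ≠ i := (Finset.mem_erase.1 hw).1
  simp_rw [edgeTangent_div _ m hwi, smul_smul]
  rw [← Finset.sum_smul]
  congr 1
  have : ∀ z, (g z + ∑ y ∈ K.erase i, g y) / 12 *
      ((if w = z then (9 : ℝ) else -3) * baryCoord K w x / inner ℝ m (w - i)) =
      (baryCoord K w x / inner ℝ m (w - i)) * ((if w = z then (g z + ∑ y ∈ K.erase i, g y) else 0)
        - (g z + ∑ y ∈ K.erase i, g y) / 4) := by
    intro z; split_ifs <;> ring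
  simp_rw [this]
  rw [← Finset.mul_sum, Finset.sum_sub_distrib, Finset.sum_ite_eq, if_pos hw, ← Finset.sum_div,
    Finset.sum_add_distrib, Finset.sum_const, hF]
  simp only [nsmul_eq_mul, Nat.cast_ofNat]
  ring

open Classical in
/-- The Brezzi-Douglas-Marini interpolant on a cell reproduces affine fields. -/
theorem bdm_reproduces_affine {K : Finset E3} (hc : K.card = 4)
    (hK : AffineIndependent ℝ ((↑) : K → E3)) {n : Finset E3 → E3}
    (hm : IsNormalFamily K fun i => n (K.erase i)) (A : E3 →ᵃ[ℝ] E3) (x : E3) :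
    ∑ F ∈ facesOf K, ∑ z ∈ F,
      ((inner ℝ (A z) (n F) + ∑ y ∈ F, inner ℝ (A y) (n F)) / 12) • bdmBasis (n F) K F z x =
      A x := by
  rw [sum_facesOf hc]
  have h3 : ∀ i ∈ K, (K.erase i).card = 3 := fun i hi => by rw [Finset.card_erase_of_mem hi, hc]
  rw [Finset.sum_congr rfl fun i hi => sum_smul_bdmBasis hi (h3 i hi) (n (K.erase i))
    (fun z => inner ℝ (A z) (n (K.erase i))) x]
  -- Regrouping by vertices instead of faces: vertex `w` collects the three faces containing it, and
  -- their contributions add up to `λ_w A(w)`.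
  rw [Finset.sum_comm' (t' := K) (s' := fun w => K.erase w)]
  · rw [Finset.sum_congr rfl fun w hw => by
      rw [← Finset.smul_sum, sum_dual_basis hc hK hm hw (A w)]]
    rw [← AffineMap.map_sum_smul A K _ (fun y => y) (sum_baryCoord hc hK x), sum_baryCoord_smul hc hK]
  · intro i w
    simp only [Finset.mem_erase]
    tauto

/-! ### Surface integrals and areas of triangles. -/

/-- The reference triangle. -/
def refTriangle : Set (EuclideanSpace ℝ (Fin 2)) := {p | 0 ≤ p 0 ∧ 0 ≤ p 1 ∧ p 0 + p 1 ≤ 1}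

theorem isClosed_refTriangle : IsClosed refTriangle := by
  have h0 : IsClosed {p : EuclideanSpace ℝ (Fin 2) | 0 ≤ p 0} :=
    isClosed_le (by fun_prop) (by fun_prop)
  have h1 : IsClosed {p : EuclideanSpace ℝ (Fin 2) | 0 ≤ p 1} :=
    isClosed_le (by fun_prop) (by fun_prop)
  have h2 : IsClosed {p : EuclideanSpace ℝ (Fin 2) | p 0 + p 1 ≤ 1} :=
    isClosed_le (by fun_prop) (by fun_prop)
  exact h0.inter (h1.inter h2)

theorem isCompact_refTriangle : IsCompact refTriangle := by
  refine Metric.isCompact_of_isClosed_isBounded isClosed_refTriangle ?_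
  refine (Metric.isBounded_iff_subset_closedBall 0).2 ⟨2, fun p hp => ?_⟩
  obtain ⟨h0, h1, h2⟩ := hp
  rw [mem_closedBall_zero_iff, EuclideanSpace.norm_eq, Real.sqrt_le_left (by norm_num)]
  simp only [Real.norm_eq_abs, sq_abs, Fin.sum_univ_two]
  nlinarith

/-- Integration of a continuous function over the reference triangle by Fubini's theorem. -/
theorem setIntegral_refTriangle (f : ℝ → ℝ → ℝ) (hf : Continuous fun p : ℝ × ℝ => f p.1 p.2) :
    ∫ p in refTriangle, f (p 0) (p 1) = ∫ s in (0 : ℝ)..1, ∫ t in (0 : ℝ)..(1 - s), f s t := by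
  set D : Set (ℝ × ℝ) := {p | 0 ≤ p.1 ∧ 0 ≤ p.2 ∧ p.1 + p.2 ≤ 1} with hD
  have hmp := (volume_preserving_finTwoArrow ℝ).comp
    (EuclideanSpace.volume_preserving_symm_measurableEquiv_toLp (Fin 2))
  have hemb : MeasurableEmbedding (MeasurableEquiv.finTwoArrow ∘
      (MeasurableEquiv.toLp 2 (Fin 2 → ℝ)).symm : EuclideanSpace ℝ (Fin 2) → ℝ × ℝ) :=
    (MeasurableEquiv.measurableEmbedding _).comp (MeasurableEquiv.measurableEmbedding _)
  have hcl : IsClosed D := by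
    have h0 : IsClosed {p : ℝ × ℝ | 0 ≤ p.1} := isClosed_le (by fun_prop) (by fun_prop)
    have h1 : IsClosed {p : ℝ × ℝ | 0 ≤ p.2} := isClosed_le (by fun_prop) (by fun_prop)
    have h2 : IsClosed {p : ℝ × ℝ | p.1 + p.2 ≤ 1} := isClosed_le (by fun_prop) (by fun_prop)
    exact h0.inter (h1.inter h2)
  have hcp : IsCompact D := by
    refine (isCompact_Icc.prod isCompact_Icc : IsCompact (Set.Icc (0 : ℝ) 1 ×ˢ Set.Icc (0 : ℝ) 1)).of_isClosed_subset
      hcl ?_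
    rintro ⟨s, t⟩ ⟨h0, h1, h2⟩
    simp only at h0 h1 h2
    exact ⟨⟨h0, by linarith⟩, ⟨h1, by linarith⟩⟩
  have h1 := hmp.setIntegral_preimage_emb hemb (fun p => f p.1 p.2) D
  have h2 : ∫ p in refTriangle, f (p 0) (p 1) = ∫ p in D, f p.1 p.2 := h1
  have hint : Integrable (D.indicator fun p => f p.1 p.2) :=
    (integrable_indicator_iff hcl.measurableSet).2 (hf.continuousOn.integrableOn_compact hcp)
  rw [h2, ← integral_indicator hcl.measurableSet, Measure.volume_eq_prod, integral_prod _ hint,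
    intervalIntegral.integral_of_le zero_le_one, ← integral_Icc_eq_integral_Ioc,
    ← integral_indicator measurableSet_Icc]
  congr 1
  funext s
  by_cases hs : s ∈ Set.Icc (0 : ℝ) 1
  · rw [Set.indicator_of_mem hs, intervalIntegral.integral_of_le (by linarith [hs.2]),
      ← integral_Icc_eq_integral_Ioc, ← integral_indicator measurableSet_Icc]
    congr 1
    funext t
    have : (s, t) ∈ D ↔ t ∈ Set.Icc 0 (1 - s) := by
      simp only [hD, Set.mem_ofPred_eq, Set.mem_Icc]
      constructor
      · rintro ⟨_, a, b⟩; exact ⟨a, by linarith⟩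
      · rintro ⟨a, b⟩; exact ⟨hs.1, a, by linarith⟩
    by_cases h : (s, t) ∈ D
    · rw [Set.indicator_of_mem h, Set.indicator_of_mem (this.1 h)]
    · rw [Set.indicator_of_notMem h, Set.indicator_of_notMem (fun h' => h (this.2 h'))]
  · rw [Set.indicator_of_notMem hs]
    have : ∀ t, D.indicator (fun p => f p.1 p.2) (s, t) = 0 := by
      intro t
      refine Set.indicator_of_notMem (fun h => hs ?_) _
      simp only [hD, Set.mem_ofPred_eq] at h
      exact ⟨h.1, by linarith [h.2.1]⟩
    simp [this]

theorem setIntegral_refTriangle_affine_mul (a b c : ℝ) :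
    ∫ p in refTriangle, (a + b * p 0 + c * p 1) * p 0 = a / 6 + b / 12 + c / 24 := by
  rw [setIntegral_refTriangle (fun s t => (a + b * s + c * t) * s) (by fun_prop)]
  have : ∀ s : ℝ, ∫ t in (0 : ℝ)..(1 - s), (a + b * s + c * t) * s =
      ((a + b * s) * (1 - s) + c * ((1 - s) ^ 2 / 2)) * s := by
    intro s
    rw [intervalIntegral.integral_mul_const, intervalIntegral.integral_add (by simp)
      (by apply Continuous.intervalIntegrable; fun_prop), intervalIntegral.integral_const_mul,
      intervalIntegral.integral_const, integral_id, smul_eq_mul]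
    ring
  simp_rw [this]
  have h2 : ∀ s : ℝ, ((a + b * s) * (1 - s) + c * ((1 - s) ^ 2 / 2)) * s =
      (a + c / 2) * s + (b - a - c) * s ^ 2 + (c / 2 - b) * s ^ 3 := by intro s; ring
  simp_rw [h2]
  rw [intervalIntegral.integral_add, intervalIntegral.integral_add]
  · rw [intervalIntegral.integral_const_mul, intervalIntegral.integral_const_mul,
      intervalIntegral.integral_const_mul, integral_pow, integral_pow, integral_id]
    norm_num
    ring
  all_goals (apply Continuous.intervalIntegrable; fun_prop)

theorem setIntegral_refTriangle_one : ∫ _p in refTriangle, (1 : ℝ) = 1 / 2 := by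
  rw [setIntegral_refTriangle (fun _ _ => 1) (by fun_prop)]
  simp only [intervalIntegral.integral_const, smul_eq_mul, mul_one, sub_zero]
  rw [intervalIntegral.integral_sub (by simp) (by simp), intervalIntegral.integral_const,
    integral_id]
  norm_num

/-- The linear map of the plane to `E3` with given images of the unit vectors. -/
def planeMap (v w : E3) : EuclideanSpace ℝ (Fin 2) →ₗ[ℝ] E3 where
  toFun p := p 0 • v + p 1 • w
  map_add' p q := by simp only [PiLp.add_apply, add_smul]; abel
  map_smul' r p := by simp only [PiLp.smul_apply, smul_eq_mul, mul_smul, smul_add, RingHom.id_apply]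

theorem surf_image_add (x : E3) (s : Set E3) : surf ((fun y => x + y) '' s) = surf s :=
  (isometry_add_left x).euclideanHausdorffMeasure_image s

theorem surf_image_affine (c v w : E3) (s : Set (EuclideanSpace ℝ (Fin 2))) :
    surf ((fun p => c + planeMap v w p) '' s) =
      ENNReal.ofReal (planeMap v w).normDet * volume s := by
  have h := (planeMap v w).euclideanHausdorffMeasure_image_eq_normDet_mul_volume s
  rw [finrank_euclideanSpace_fin] at h
  rw [← h, ← Set.image_image (fun y => c + y) (planeMap v w) s, surf_image_add]
  rfl

theorem baryCoord_triangle {F : Finset E3} {a b c : E3}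
    (hF : AffineIndependent ℝ ((↑) : F → E3)) (hab : a ≠ b) (hac : a ≠ c) (hbc : b ≠ c)
    (h : F = {a, b, c}) (p : EuclideanSpace ℝ (Fin 2)) :
    baryCoord F a (c + planeMap (a - c) (b - c) p) = p 0 := by
  classical
  have := @baryCoord_eq F hF (fun y => if y = a then p 0 else if y = b then p 1 else 1 - p 0 - p 1)
    (c + planeMap (a - c) (b - c) p) ?_ ?_ a (by simp [h])
  · simpa using this
  · subst h
    rw [Finset.sum_insert (by simp [hab, hac]), Finset.sum_pair hbc]
    simp [hab.symm, hac.symm, hbc.symm]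
  · subst h
    rw [Finset.sum_insert (by simp [hab, hac]), Finset.sum_pair hbc]
    simp only [hab.symm, hac.symm, hbc.symm, if_true, if_false, planeMap, LinearMap.coe_mk,
      AddHom.coe_mk, sub_smul, smul_sub, one_smul]
    abel

/-- The parameters are barycentric coordinates of the image point: the first by
`baryCoord_triangle`, the second by the same lemma with `a` and `b` exchanged. -/
theorem planeMap_injective {F : Finset E3} {a b c : E3}
    (hF : AffineIndependent ℝ ((↑) : F → E3)) (hab : a ≠ b) (hac : a ≠ c) (hbc : b ≠ c)
    (h : F = {a, b, c}) : Function.Injective (planeMap (a - c) (b - c)) := by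
  have h' : F = {b, a, c} := by rw [h]; exact Finset.insert_comm _ _ _
  intro p q hpq
  have e0 := baryCoord_triangle hF hab hac hbc h p
  rw [hpq, baryCoord_triangle hF hab hac hbc h q] at e0
  have hsw : ∀ r, planeMap (a - c) (b - c) r = planeMap (b - c) (a - c) !₂[r 1, r 0] := by
    intro r; simp [planeMap, add_comm]
  have e1 := baryCoord_triangle hF hab.symm hbc hac h' !₂[p 1, p 0]
  rw [← hsw, hpq, hsw, baryCoord_triangle hF hab.symm hbc hac h' !₂[q 1, q 0]] at e1
  ext i
  fin_cases i
  · exact e0.symm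
  · simpa using e1.symm

theorem hull_triangle {F : Finset E3} {a b c : E3} (hab : a ≠ b) (hac : a ≠ c) (hbc : b ≠ c)
    (h : F = {a, b, c}) :
    hull F = (fun p => c + planeMap (a - c) (b - c) p) '' refTriangle := by
  classical
  subst h
  ext x
  rw [hull, Finset.mem_convexHull']
  constructor
  · rintro ⟨w, h0, h1, rfl⟩
    rw [Finset.sum_insert (by simp [hab, hac]), Finset.sum_pair hbc] at h1 ⊢
    have ha := h0 a (by simp)
    have hb := h0 b (by simp)
    have hc := h0 c (by simp)
    refine ⟨!₂[w a, w b], ⟨by simpa using ha, by simpa using hb, by simp; linarith⟩, ?_⟩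
    have : w c = 1 - w a - w b := by linarith
    simp only [planeMap, LinearMap.coe_mk, AddHom.coe_mk, this, sub_smul, smul_sub, one_smul,
      Matrix.cons_val_zero, Matrix.cons_val_one]
    abel
  · rintro ⟨p, ⟨h0, h1, h2⟩, rfl⟩
    refine ⟨fun y => if y = a then p 0 else if y = b then p 1 else 1 - p 0 - p 1, ?_, ?_, ?_⟩
    · intro y _
      dsimp only
      split_ifs
      · exact h0
      · exact h1
      · linarith
    · rw [Finset.sum_insert (by simp [hab, hac]), Finset.sum_pair hbc]
      simp [hab.symm, hac.symm, hbc.symm]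
    · rw [Finset.sum_insert (by simp [hab, hac]), Finset.sum_pair hbc]
      simp only [hab.symm, hac.symm, hbc.symm, if_true, if_false, planeMap, LinearMap.coe_mk,
        AddHom.coe_mk, sub_smul, smul_sub, one_smul]
      abel

/-- Surface measure on the triangle is the push-forward of plane measure, scaled by the constant
Jacobian `normDet`. -/
theorem setIntegral_hull_triangle {F : Finset E3} {a b c : E3}
    (hF : AffineIndependent ℝ ((↑) : F → E3)) (hab : a ≠ b) (hac : a ≠ c) (hbc : b ≠ c)
    (h : F = {a, b, c}) (f : E3 → ℝ) :
    ∫ x in hull F, f x ∂surf = (planeMap (a - c) (b - c)).normDet *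
      ∫ p in refTriangle, f (c + planeMap (a - c) (b - c) p) := by
  set φ := fun p => c + planeMap (a - c) (b - c) p with hφ
  have hcont : Continuous φ :=
    continuous_const.add (LinearMap.continuous_of_finiteDimensional _)
  have hemb : MeasurableEmbedding φ := hcont.measurableEmbedding
    ((add_right_injective c).comp (planeMap_injective hF hab hac hbc h))
  have hres : surf.restrict (hull F) = ENNReal.ofReal (planeMap (a - c) (b - c)).normDet •
      Measure.map φ (volume.restrict refTriangle) := by
    ext B hB
    rw [Measure.restrict_apply hB, hull_triangle hab hac hbc h, Measure.smul_apply,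
      hemb.map_apply, Measure.restrict_apply (hcont.measurable hB), smul_eq_mul,
      ← surf_image_affine c, Set.image_preimage_inter]
  rw [hres, integral_smul_measure, hemb.integral_map,
    ENNReal.toReal_ofReal (LinearMap.normDet_nonneg _), smul_eq_mul]

theorem exists_triangle {F : Finset E3} (hc : F.card = 3) {z : E3} (hz : z ∈ F) :
    ∃ b c, z ≠ b ∧ z ≠ c ∧ b ≠ c ∧ F = {z, b, c} := by
  classical
  obtain ⟨b, c, hbc, h⟩ := Finset.card_eq_two.1
    (show (F.erase z).card = 2 by rw [Finset.card_erase_of_mem hz, hc])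
  have hb : b ∈ F.erase z := by simp [h]
  have hc : c ∈ F.erase z := by simp [h]
  exact ⟨b, c, (Finset.ne_of_mem_erase hb).symm, (Finset.ne_of_mem_erase hc).symm, hbc,
    by rw [← Finset.insert_erase hz, h]⟩

theorem isCompact_hull (S : Finset E3) : IsCompact (hull S) :=
  S.finite_toSet.isCompact_convexHull ℝ

theorem surf_hull_lt_top {F : Finset E3} (hc : F.card = 3) : surf (hull F) < ⊤ := by
  obtain ⟨a, b, c, hab, hac, hbc, h⟩ := Finset.card_eq_three.1 hc
  rw [hull_triangle hab hac hbc h, surf_image_affine]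
  exact ENNReal.mul_lt_top ENNReal.ofReal_lt_top isCompact_refTriangle.measure_lt_top

/-- The moments of an affine function on a triangle against a barycentric coordinate. -/
theorem average_affine_mul_baryCoord {F : Finset E3} (hc : F.card = 3)
    (hF : AffineIndependent ℝ ((↑) : F → E3)) (g : E3 →ᵃ[ℝ] ℝ) {z : E3} (hz : z ∈ F) :
    (surf.real (hull F))⁻¹ * ∫ x in hull F, g x * baryCoord F z x ∂surf =
      (g z + ∑ y ∈ F, g y) / 12 := by
  classical
  obtain ⟨b, c, hab, hac, hbc, h⟩ := exists_triangle hc hz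
  have hd : (planeMap (z - c) (b - c)).normDet ≠ 0 := by
    rw [Ne, LinearMap.normDet_eq_zero_iff_ker_ne_bot, not_not, LinearMap.ker_eq_bot]
    exact planeMap_injective hF hab hac hbc h
  have hF1 : surf.real (hull F) = (planeMap (z - c) (b - c)).normDet * (1 / 2) := by
    rw [← setIntegral_refTriangle_one, ← setIntegral_hull_triangle hF hab hac hbc h fun _ => 1]
    simp
  have hg : ∀ p, g (c + planeMap (z - c) (b - c) p) =
      g c + (g z - g c) * p 0 + (g b - g c) * p 1 := by
    intro p
    have hA : ∀ v, g v = g.linear v + g 0 := fun v => congrFun g.decomp v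
    rw [hA, hA c, hA z, hA b]
    simp [planeMap]
    ring
  rw [hF1, setIntegral_hull_triangle hF hab hac hbc h]
  simp_rw [baryCoord_triangle hF hab hac hbc h, hg]
  rw [setIntegral_refTriangle_affine_mul, h, Finset.sum_insert (by simp [hab, hac]),
    Finset.sum_pair hbc]
  field_simp
  ring

/-- The Cauchy-Schwarz inequality on a face. -/
theorem abs_integral_mul_baryCoord_le {F : Finset E3} (hc : F.card = 3)
    (hF : AffineIndependent ℝ ((↑) : F → E3)) {J : E3 → ℝ} (hJ : Continuous J) {z : E3}
    (hz : z ∈ F) :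
    |∫ x in hull F, J x * baryCoord F z x ∂surf| ≤
      l2Norm surf (hull F) J * √(surf.real (hull F)) := by
  have : IsFiniteMeasure (surf.restrict (hull F)) :=
    ⟨by rw [Measure.restrict_apply_univ]; exact surf_hull_lt_top hc⟩
  have hm : MeasurableSet (hull F) := (isCompact_hull F).measurableSet
  obtain ⟨C, hC⟩ := (isCompact_hull F).exists_bound_of_continuousOn hJ.continuousOn
  have hbd : ∀ᵐ x ∂(surf.restrict (hull F)), ‖J x‖ ≤ C :=
    ae_restrict_of_forall_mem hm hC
  have hmem : ∀ p, MemLp J p (surf.restrict (hull F)) := fun p =>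
    MemLp.of_bound hJ.aestronglyMeasurable C hbd
  have h1 : ‖∫ x in hull F, J x * baryCoord F z x ∂surf‖ ≤ ∫ x in hull F, ‖J x‖ ∂surf := by
    refine norm_integral_le_of_norm_le ((memLp_one_iff_integrable.1 (hmem 1)).norm) ?_
    refine ae_restrict_of_forall_mem hm fun x hx => ?_
    rw [norm_mul]
    exact mul_le_of_le_one_right (norm_nonneg _) (abs_baryCoord_le_one hF hx hz)
  have h2 := eLpNorm_le_eLpNorm_mul_rpow_measure_univ (μ := surf.restrict (hull F)) (f := J)
    (p := 1) (q := 2) (by norm_num) hJ.aestronglyMeasurable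
  have h3 : ∫ x in hull F, ‖J x‖ ∂surf = (eLpNorm J 1 (surf.restrict (hull F))).toReal := by
    rw [integral_norm_eq_lintegral_enorm hJ.aestronglyMeasurable, eLpNorm_one_eq_lintegral_enorm]
  rw [Real.norm_eq_abs, h3] at h1
  refine h1.trans ?_
  have h4 := ENNReal.toReal_mono
    (ENNReal.mul_ne_top (hmem 2).2.ne (ENNReal.rpow_ne_top_of_nonneg (by norm_num)
      (measure_ne_top _ _))) h2
  rw [ENNReal.toReal_mul, ← ENNReal.toReal_rpow, Measure.restrict_apply_univ] at h4
  have h5 : (1 : ℝ) / ENNReal.toReal 1 - 1 / ENNReal.toReal 2 = 1 / 2 := by norm_num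
  rw [h5] at h4
  rw [Real.sqrt_eq_rpow]
  exact h4

/-- A disk has the area of a plane disk of the same radius. -/
theorem le_surf_real_of_disk_subset {m : E3} (hm : m ≠ 0) {S : Set E3} (hS : surf S < ⊤)
    {q : E3} {r : ℝ} (hr : 0 ≤ r)
    (h : ∀ v, inner ℝ m v = 0 → ‖v‖ ≤ r → q + v ∈ S) :
    r ^ 2 * volume.real (Metric.ball (0 : EuclideanSpace ℝ (Fin 2)) 1) ≤ surf.real S := by
  have : Fact (Module.finrank ℝ E3 = 2 + 1) := ⟨finrank_euclideanSpace_fin⟩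
  let e := (stdOrthonormalBasis ℝ (ℝ ∙ m)ᗮ).reindex
    (finCongr (Submodule.finrank_orthogonal_span_singleton (𝕜 := ℝ) (E := E3) (n := 2) hm))
  let L : EuclideanSpace ℝ (Fin 2) →ₗᵢ[ℝ] E3 :=
    (ℝ ∙ m)ᗮ.subtypeₗᵢ.comp e.repr.symm.toLinearIsometry
  have hL : ∀ p, inner ℝ m (L p) = 0 := fun p =>
    Submodule.mem_orthogonal_singleton_iff_inner_right.1 (e.repr.symm p).2
  have hsub : (fun p => q + L p) '' Metric.ball 0 r ⊆ S := by
    rintro _ ⟨p, hp, rfl⟩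
    refine h _ (hL p) ?_
    rw [L.norm_map]
    exact (mem_ball_zero_iff.1 hp).le
  have hiso : Isometry fun p => q + L p := (isometry_add_left q).comp L.isometry
  have hv : surf ((fun p => q + L p) '' Metric.ball 0 r) =
      volume (Metric.ball (0 : EuclideanSpace ℝ (Fin 2)) r) := by
    rw [← EuclideanSpace.euclideanHausdorffMeasure_eq_volume]
    exact hiso.euclideanHausdorffMeasure_image _
  have hb := Measure.addHaar_ball (volume : Measure (EuclideanSpace ℝ (Fin 2))) 0 hr
  rw [finrank_euclideanSpace_fin] at hb
  have := measureReal_mono hsub hS.ne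
  rw [measureReal_def, hv, hb, ENNReal.toReal_mul, ENNReal.toReal_ofReal (by positivity)] at this
  exact this

/-! ### Normals, heights and face areas of a cell. -/

theorem erase_mem_facesOf [DecidableEq E3] {K : Finset E3} (hc : K.card = 4) {i : E3}
    (hi : i ∈ K) : K.erase i ∈ facesOf K :=
  Finset.mem_powersetCard.2 ⟨Finset.erase_subset _ _, by rw [Finset.card_erase_of_mem hi, hc]⟩

theorem exists_erase_of_mem_facesOf [DecidableEq E3] {K F : Finset E3} (hc : K.card = 4)
    (hF : F ∈ facesOf K) : ∃ i ∈ K, F = K.erase i := by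
  rw [facesOf, Finset.mem_powersetCard] at hF
  have : (K \ F).card = 1 := by rw [Finset.card_sdiff_of_subset hF.1]; omega
  obtain ⟨i, hi⟩ := Finset.card_eq_one.1 this
  have hi' : i ∈ K \ F := by rw [hi]; simp
  exact ⟨i, (Finset.mem_sdiff.1 hi').1,
    by rw [Finset.erase_eq, ← hi, Finset.sdiff_sdiff_eq_self hF.1]⟩

theorem inner_sum_smul_sub {K : Finset E3} {w : E3 → ℝ} (h1 : ∑ y ∈ K, w y = 1) (m a : E3) :
    inner ℝ m ((∑ y ∈ K, w y • y) - a) = ∑ y ∈ K, w y * inner ℝ m (y - a) := by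
  have : (∑ y ∈ K, w y • y) - a = ∑ y ∈ K, w y • (y - a) := by
    simp_rw [smul_sub]
    rw [Finset.sum_sub_distrib, ← Finset.sum_smul, h1, one_smul]
  rw [this, inner_sum]
  simp_rw [inner_smul_right]

namespace TetMesh

variable {T : TetMesh} {n : Finset E3 → E3}

open Classical in
theorem IsFaceNormal.isNormalFamily (hn : T.IsFaceNormal n) {K : Finset E3} (hK : K ∈ T.cells) :
    IsNormalFamily K fun i => n (K.erase i) := by
  have hc := T.card_eq K hK
  have hperp : ∀ i ∈ K, ∀ y ∈ K, ∀ z ∈ K, y ≠ i → z ≠ i →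
      inner ℝ (n (K.erase i)) (y - z) = 0 := fun i hi y hy z hz hyi hzi =>
    (hn K hK _ (erase_mem_facesOf hc hi)).2.1 y (Finset.mem_erase.2 ⟨hyi, hy⟩) z
      (Finset.mem_erase.2 ⟨hzi, hz⟩)
  refine ⟨hperp, fun i hi y hy hyi h0 => ?_⟩
  have hnorm := (hn K hK _ (erase_mem_facesOf hc hi)).1
  -- If the product vanished, the normal would be orthogonal to all edges of `K`. Expanding the
  -- point `y + n` in barycentric coordinates would then give `‖n‖² = 0`.
  obtain ⟨w, h1, hw⟩ := exists_baryCoord hc (T.indep K hK) (y + n (K.erase i))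
  have h := inner_sum_smul_sub h1 (n (K.erase i)) y
  rw [hw, Finset.sum_eq_zero, add_sub_cancel_left, real_inner_self_eq_norm_sq, hnorm] at h
  · norm_num at h
  · intro z hz
    by_cases hzi : z = i
    · rw [hzi, ← neg_sub, inner_neg_right, h0]; simp
    · rw [hperp i hi z hz y hy hzi hyi, mul_zero]

end TetMesh

section CellGeometry

variable {K : Finset E3} {m i : E3} {d r : ℝ} {p : E3}

/-- Under `hd` the linear functional given by `m` is constant on the face opposite to `i`, so the
distance from `i` along `m` is an affine function of `λ_i` alone. -/
theorem inner_sub_vertex (hi : i ∈ K) (hd : ∀ y ∈ K, y ≠ i → inner ℝ m (y - i) = d)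
    {w : E3 → ℝ} (h1 : ∑ y ∈ K, w y = 1) {x : E3} (hx : ∑ y ∈ K, w y • y = x) :
    inner ℝ m (x - i) = (1 - w i) * d := by
  classical
  rw [← hx, inner_sum_smul_sub h1, ← Finset.add_sum_erase _ _ hi]
  rw [← Finset.add_sum_erase _ _ hi] at h1
  rw [Finset.sum_congr rfl fun y hy => by
    rw [hd y (Finset.mem_of_mem_erase hy) (Finset.ne_of_mem_erase hy)], ← Finset.sum_mul,
    sub_self, inner_zero_right, mul_zero, zero_add, ← h1]
  ring

theorem exists_mem_hull_coord (hi : i ∈ K) (hd : ∀ y ∈ K, y ≠ i → inner ℝ m (y - i) = d)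
    {x : E3} (hx : x ∈ hull K) : ∃ t, 0 ≤ t ∧ t ≤ 1 ∧ inner ℝ m (x - i) = t * d := by
  obtain ⟨w, h0, h1, hw⟩ := Finset.mem_convexHull'.1 hx
  refine ⟨1 - w i, ?_, ?_, inner_sub_vertex hi hd h1 hw⟩
  · have := Finset.single_le_sum h0 hi
    linarith
  · linarith [h0 i hi]

/-- The height of a simplex is at least the diameter of an inscribed ball. -/
theorem two_mul_radius_le_height (hi : i ∈ K) (hm : ‖m‖ = 1)
    (hd : ∀ y ∈ K, y ≠ i → inner ℝ m (y - i) = d) (hr : 0 ≤ r)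
    (hball : Metric.closedBall p r ⊆ hull K) : 2 * r ≤ |d| := by
  have hmem : ∀ s : ℝ, |s| = r → p + s • m ∈ hull K := fun s hs => hball (by
    rw [Metric.mem_closedBall, dist_eq_norm, add_sub_cancel_left, norm_smul, hm, mul_one,
      Real.norm_eq_abs, hs])
  -- Both ends of the diameter parallel to `m` lie in the slab of width `|d|` that contains the
  -- simplex.
  obtain ⟨t, ht0, ht1, ht⟩ := exists_mem_hull_coord hi hd (hmem r (abs_of_nonneg hr))
  obtain ⟨s, hs0, hs1, hs⟩ := exists_mem_hull_coord hi hd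
    (hmem (-r) (by rw [abs_neg, abs_of_nonneg hr]))
  have e : ∀ a : ℝ, inner ℝ m (p + a • m - i) = inner ℝ m (p - i) + a := by
    intro a
    rw [add_sub_right_comm, inner_add_right, inner_smul_right, real_inner_self_eq_norm_sq, hm]
    ring
  rw [e] at ht hs
  have h2 : 2 * r = (t - s) * d := by linarith
  calc 2 * r = |(t - s) * d| := by rw [← h2, abs_of_nonneg (by linarith)]
    _ = |t - s| * |d| := abs_mul _ _
    _ ≤ 1 * |d| := mul_le_mul_of_nonneg_right (abs_le.2 ⟨by linarith, by linarith⟩) (abs_nonneg _)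
    _ = |d| := one_mul _

open Classical in
/-- The area of a face of a simplex is at least that of a disk with the radius of an inscribed
ball. -/
theorem le_surf_real_face (hc : K.card = 4) (hi : i ∈ K) (hm : ‖m‖ = 1)
    (hd : ∀ y ∈ K, y ≠ i → inner ℝ m (y - i) = d) (hr : 0 < r)
    (hball : Metric.closedBall p r ⊆ hull K) :
    r ^ 2 * volume.real (Metric.ball (0 : EuclideanSpace ℝ (Fin 2)) 1) ≤
      surf.real (hull (K.erase i)) := by
  have hd0 : d ≠ 0 := by
    have := two_mul_radius_le_height hi hm hd hr.le hball
    exact abs_pos.1 (by linarith)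
  obtain ⟨w, h0, h1, hw⟩ := Finset.mem_convexHull'.1 (hball (Metric.mem_closedBall_self hr.le))
  have hp := inner_sub_vertex hi hd h1 hw
  -- Otherwise the centre would have the same height as the vertex `i`, and the ball would reach to
  -- both sides of it, whereas the simplex stays on one side.
  have hwi : 0 < 1 - w i := by
    have hle : w i ≤ 1 := h1 ▸ Finset.single_le_sum h0 hi
    refine lt_of_le_of_ne (by linarith) fun h => ?_
    have hmem : ∀ s : ℝ, |s| = r → p + s • m ∈ hull K := fun s hs => hball (by
      rw [Metric.mem_closedBall, dist_eq_norm, add_sub_cancel_left, norm_smul, hm, mul_one,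
        Real.norm_eq_abs, hs])
    obtain ⟨t, ht0, ht1, ht⟩ := exists_mem_hull_coord hi hd (hmem r (abs_of_pos hr))
    obtain ⟨s, hs0, hs1, hs⟩ := exists_mem_hull_coord hi hd
      (hmem (-r) (by rw [abs_neg, abs_of_pos hr]))
    have e : ∀ a : ℝ, inner ℝ m (p + a • m - i) = a := by
      intro a
      rw [add_sub_right_comm, inner_add_right, inner_smul_right, real_inner_self_eq_norm_sq, hm,
        hp, ← h]
      ring
    rw [e] at ht hs
    rcases lt_or_gt_of_ne hd0 with hneg | hpos
    · nlinarith
    · nlinarith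
  -- The centre of the disk is the projection of `p` from `i` onto the face. The dilation about `i`
  -- by `(1 - w i)⁻¹ ≥ 1` takes the slice of the ball through `p` parallel to the face into the
  -- face.
  refine le_surf_real_of_disk_subset (m := m) (by rintro rfl; simp at hm)
    (surf_hull_lt_top (by rw [Finset.card_erase_of_mem hi, hc])) (q := (1 - w i)⁻¹ • (p - w i • i))
    hr.le fun v hv hvr => ?_
  have hmem : p + (1 - w i) • v ∈ hull K := hball (by
    rw [Metric.mem_closedBall, dist_eq_norm, add_sub_cancel_left, norm_smul, Real.norm_eq_abs,
      abs_of_pos hwi]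
    have : 1 - w i ≤ 1 := by linarith [h0 i hi]
    nlinarith [norm_nonneg v])
  obtain ⟨w', h0', h1', hw'⟩ := Finset.mem_convexHull'.1 hmem
  have hp' := inner_sub_vertex hi hd h1' hw'
  rw [add_sub_right_comm, inner_add_right, inner_smul_right, hv, mul_zero, add_zero, hp] at hp'
  have heq : w' i = w i := by
    have := mul_right_cancel₀ hd0 hp'
    linarith
  refine Finset.mem_convexHull'.2 ⟨fun y => (1 - w i)⁻¹ * w' y, ?_, ?_, ?_⟩
  · intro y hy
    exact mul_nonneg (inv_nonneg.2 hwi.le) (h0' y (Finset.mem_of_mem_erase hy))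
  · rw [← Finset.add_sum_erase _ _ hi, heq] at h1'
    rw [← Finset.mul_sum, eq_sub_of_add_eq' h1', inv_mul_cancel₀ hwi.ne']
  · rw [← Finset.add_sum_erase _ _ hi, heq] at hw'
    simp_rw [mul_smul]
    rw [← Finset.smul_sum, eq_sub_of_add_eq' hw', add_sub_right_comm, smul_add, smul_smul,
      inv_mul_cancel₀ hwi.ne', one_smul]

theorem norm_sub_le_diam_hull {S : Finset E3} {x y : E3} (hx : x ∈ S) (hy : y ∈ S) :
    ‖x - y‖ ≤ Metric.diam (hull S) := by
  rw [← dist_eq_norm]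
  exact Metric.dist_le_diam_of_mem (isCompact_hull S).isBounded (subset_convexHull ℝ _ hx)
    (subset_convexHull ℝ _ hy)

theorem volume_real_hull_le (hK : K.Nonempty) :
    volume.real (hull K) ≤ Metric.diam (hull K) ^ 3 * volume.real (Metric.ball (0 : E3) 1) := by
  obtain ⟨z, hz⟩ := hK
  have hsub : hull K ⊆ Metric.closedBall z (Metric.diam (hull K)) := fun x hx =>
    Metric.mem_closedBall.2 (Metric.dist_le_diam_of_mem (isCompact_hull K).isBounded hx
      (subset_convexHull ℝ _ hz))
  have hb := Measure.addHaar_closedBall (volume : Measure E3) z (Metric.diam_nonneg (s := hull K))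
  rw [finrank_euclideanSpace_fin] at hb
  have := measureReal_mono hsub measure_closedBall_lt_top.ne (μ := (volume : Measure E3))
  refine this.trans_eq ?_
  rw [measureReal_def, hb, ENNReal.toReal_mul, ENNReal.toReal_ofReal (by positivity),
    measureReal_def]

end CellGeometry

/-! ### The two sides of a face and the weighted average of the traces. -/

namespace TetMesh

variable {T : TetMesh} {n : Finset E3 → E3}

open Classical in
/-- At most one cell lies on a given side of a face. -/
theorem eq_of_inwardFor {m : E3} {F K L : Finset E3} (hK : K ∈ T.cells) (hL : L ∈ T.cells)
    (hFK : F ∈ facesOf K) (hFL : F ∈ facesOf L)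
    (hm : ∀ y ∈ F, ∀ z ∈ F, inner ℝ m (y - z) = 0)
    (hmK : InwardFor m F K) (hmL : InwardFor m F L) : K = L := by
  by_contra hne
  have hcK := T.card_eq K hK
  have hcL := T.card_eq L hL
  have hF3 : F.card = 3 := (Finset.mem_powersetCard.1 hFK).2
  obtain ⟨i, hi, rfl⟩ := exists_erase_of_mem_facesOf hcK hFK
  obtain ⟨j, hj, hij⟩ := exists_erase_of_mem_facesOf hcL hFL
  set F := K.erase i with hF
  have hFK' : F ⊆ K := Finset.erase_subset _ _
  have hFL' : F ⊆ L := hij ▸ Finset.erase_subset _ _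
  have hinter : K ∩ L = F := by
    refine (Finset.eq_of_subset_of_card_le (Finset.subset_inter hFK' hFL') ?_).symm
    by_contra hlt
    push Not at hlt
    have h1 : K ∩ L = K := Finset.eq_of_subset_of_card_le Finset.inter_subset_left (by omega)
    have h2 : K ∩ L = L := Finset.eq_of_subset_of_card_le Finset.inter_subset_right (by omega)
    exact hne (h1.symm.trans h2)
  have hhull : hull K ∩ hull L = hull F := by
    rw [T.inter K hK L hL, hull, ← hinter, Finset.coe_inter]
  obtain ⟨y₀, hy₀⟩ : F.Nonempty := Finset.card_pos.1 (by omega)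
  have hiF : i ∉ F := by simp [hF]
  have hjF : j ∉ F := by rw [hij]; simp
  have hpi := hmK y₀ hy₀ i hi hiF
  have hpj := hmL y₀ hy₀ j hj hjF
  obtain ⟨c, hc1, hc⟩ := exists_baryCoord hcL (T.indep L hL) i
  have hLs : ∀ {M : Type} [AddCommMonoid M] (f : E3 → M), ∑ y ∈ L, f y = f j + ∑ y ∈ F, f y := by
    intro M _ f
    rw [← Finset.add_sum_erase _ _ hj, ← hij]
  -- Only `j` contributes to the normal component of `i - y₀`, and `i` and `j` lie on the same side
  -- of the face.
  have hcj : 0 ≤ c j := by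
    have h := inner_sum_smul_sub hc1 m y₀
    rw [hc, hLs, Finset.sum_eq_zero (s := F) fun y hy => by rw [hm y hy y₀ hy₀, mul_zero],
      add_zero] at h
    rw [h] at hpi
    exact (pos_of_mul_pos_left hpi hpj.le).le
  set M := ∑ y ∈ F, |c y| with hM
  have hM0 : 0 ≤ M := Finset.sum_nonneg fun _ _ => abs_nonneg _
  -- With this `t`, `(1 - t) / 3 = t * M`, which compensates every negative `t * c y`. So the
  -- barycenter of `F`, moved by `t` towards `i`, lies in both cells. By conformity it lies in `F`,
  -- although its normal component is positive.
  set t := (1 + 3 * M)⁻¹ with ht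
  have ht0 : 0 < t := inv_pos.2 (by linarith)
  have ht1 : t * (1 + 3 * M) = 1 := inv_mul_cancel₀ (by linarith)
  have htle : t ≤ 1 := by nlinarith
  set x := (∑ y ∈ F, ((1 - t) / 3) • y) + t • i with hx
  have hsum3 : ∑ y ∈ F, (1 - t) / 3 = 1 - t := by
    rw [Finset.sum_const, hF3]
    simp only [nsmul_eq_mul, Nat.cast_ofNat]
    ring
  have hxK : x ∈ hull K := by
    refine Finset.mem_convexHull'.2 ⟨fun y => if y = i then t else (1 - t) / 3, ?_, ?_, ?_⟩
    · intro y _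
      dsimp only
      split_ifs
      · exact ht0.le
      · exact div_nonneg (by linarith) (by norm_num)
    · rw [← Finset.add_sum_erase _ _ hi, if_pos rfl, Finset.sum_congr rfl fun y hy =>
        if_neg (Finset.ne_of_mem_erase hy), hsum3]
      ring
    · dsimp only
      rw [← Finset.add_sum_erase _ _ hi, if_pos rfl, Finset.sum_congr rfl fun y hy => by
        rw [if_neg (Finset.ne_of_mem_erase hy)], hx, add_comm]
  have hxL : x ∈ hull L := by
    refine Finset.mem_convexHull'.2 ⟨fun y => t * c y + if y = j then 0 else (1 - t) / 3,
      ?_, ?_, ?_⟩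
    · intro y hy
      dsimp only
      split_ifs with h
      · rw [h, add_zero]
        exact mul_nonneg ht0.le hcj
      · have hyF : y ∈ F := by rw [hij]; exact Finset.mem_erase.2 ⟨h, hy⟩
        have h1 : |c y| ≤ M := Finset.single_le_sum (f := fun y => |c y|)
          (fun _ _ => abs_nonneg _) hyF
        have h2 := neg_abs_le (c y)
        nlinarith
    · rw [Finset.sum_add_distrib, ← Finset.mul_sum, hc1, hLs, if_pos rfl,
        Finset.sum_congr rfl fun y hy => if_neg (ne_of_mem_of_not_mem hy hjF), hsum3]
      ring
    · simp_rw [add_smul, mul_smul]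
      rw [Finset.sum_add_distrib, ← Finset.smul_sum, hc, hLs, if_pos rfl, zero_smul, zero_add,
        Finset.sum_congr rfl fun y hy => by rw [if_neg (ne_of_mem_of_not_mem hy hjF)], hx, add_comm]
  have hxF : x ∈ hull F := hhull ▸ ⟨hxK, hxL⟩
  obtain ⟨w, -, h1, hw⟩ := Finset.mem_convexHull'.1 hxF
  have h0 := inner_sum_smul_sub h1 m y₀
  rw [hw, Finset.sum_eq_zero fun y hy => by rw [hm y hy y₀ hy₀, mul_zero]] at h0
  have h2 : x - y₀ = (∑ y ∈ F, ((1 - t) / 3) • (y - y₀)) + t • (i - y₀) := by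
    simp_rw [smul_sub]
    rw [Finset.sum_sub_distrib, ← Finset.sum_smul, hsum3, hx]
    module
  rw [h2, inner_add_right, inner_sum, Finset.sum_eq_zero fun y hy => by
    rw [inner_smul_right, hm y hy y₀ hy₀, mul_zero], zero_add, inner_smul_right] at h0
  exact (mul_pos ht0 hpi).ne' h0

theorem IsPlus.unique (hn : T.IsFaceNormal n) {F K L : Finset E3} (hK : T.IsPlus n F K)
    (hL : T.IsPlus n F L) : L = K :=
  eq_of_inwardFor hL.1 hK.1 hL.2.1 hK.2.1 (hn K hK.1 F hK.2.1).2.1 hL.2.2 hK.2.2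

theorem IsMinus.unique (hn : T.IsFaceNormal n) {F K L : Finset E3} (hK : T.IsMinus n F K)
    (hL : T.IsMinus n F L) : L = K := by
  have hneg : ∀ {M}, OutwardFor (n F) F M → InwardFor (-n F) F M := fun h y hy z hz hzF => by
    rw [inner_neg_left]; exact neg_pos.2 (h y hy z hz hzF)
  refine eq_of_inwardFor hL.1 hK.1 hL.2.1 hK.2.1 (m := -n F) (fun y hy z hz => ?_)
    (hneg hL.2.2) (hneg hK.2.2)
  rw [inner_neg_left, (hn K hK.1 F hK.2.1).2.1 y hy z hz, neg_zero]

theorem minusVal_eq {V : Type*} [Zero V] (hn : T.IsFaceNormal n) (v : Finset E3 → V)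
    {F K : Finset E3} (hK : T.IsMinus n F K) : T.minusVal n v F = v K := by
  have h : ∃ L, T.IsMinus n F L := ⟨K, hK⟩
  rw [minusVal, dif_pos h, hK.unique hn h.choose_spec]

theorem plusVal_eq {V : Type*} [Zero V] (hn : T.IsFaceNormal n) (v : Finset E3 → V)
    {F K : Finset E3} (hK : T.IsPlus n F K) : T.plusVal n v F = v K := by
  have h : ∃ L, T.IsPlus n F L := ⟨K, hK⟩
  rw [plusVal, dif_pos h, hK.unique hn h.choose_spec]

theorem plusVal_eq_zero {V : Type*} [Zero V] (v : Finset E3 → V) {F : Finset E3}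
    (h : ¬∃ L, T.IsPlus n F L) : T.plusVal n v F = 0 := by
  rw [plusVal, dif_neg h]

open Classical in
theorem isMinus_or_isPlus (hn : T.IsFaceNormal n) {K F : Finset E3} (hK : K ∈ T.cells)
    (hF : F ∈ facesOf K) : T.IsMinus n F K ∨ T.IsPlus n F K := by
  have hc := T.card_eq K hK
  obtain ⟨i, hi, rfl⟩ := exists_erase_of_mem_facesOf hc hF
  have hm := hn.isNormalFamily hK
  obtain ⟨y₀, hy₀⟩ : (K.erase i).Nonempty :=
    Finset.card_pos.1 (by rw [Finset.card_erase_of_mem hi, hc]; norm_num)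
  have hopp : ∀ z ∈ K, z ∉ K.erase i → z = i := fun z hz hzF => by
    by_contra h
    exact hzF (Finset.mem_erase.2 ⟨h, hz⟩)
  have hconst : ∀ y ∈ K.erase i, inner ℝ (n (K.erase i)) (i - y) =
      inner ℝ (n (K.erase i)) (i - y₀) := by
    intro y hy
    have := (hn K hK _ hF).2.1 y₀ hy₀ y hy
    rw [← sub_add_sub_cancel i y₀ y, inner_add_right, this, add_zero]
  have hne : inner ℝ (n (K.erase i)) (i - y₀) ≠ 0 := by
    have := hm.ne_zero i hi y₀ (Finset.mem_of_mem_erase hy₀) (Finset.ne_of_mem_erase hy₀)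
    rwa [← neg_sub, inner_neg_right, neg_ne_zero]
  rcases lt_or_gt_of_ne hne with h | h
  · exact Or.inl ⟨hK, hF, fun y hy z hz hzF => by rw [hopp z hz hzF, hconst y hy]; exact h⟩
  · exact Or.inr ⟨hK, hF, fun y hy z hz hzF => by rw [hopp z hz hzF, hconst y hy]; exact h⟩

theorem sqrt_half_le {a b : ℝ} (ha : 0 ≤ a) (hb : 0 ≤ b) : √((a + b) / 2) ≤ √a + √b := by
  rw [Real.sqrt_le_left (by positivity)]
  nlinarith [Real.sq_sqrt ha, Real.sq_sqrt hb, mul_nonneg (Real.sqrt_nonneg a) (Real.sqrt_nonneg b)]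

/-- The recovered normal flux on a face of `K` differs from that of `K` by a multiple of the jump,
and the multiple is controlled independently of the jump of `β`. -/
theorem exists_tauFace_sub_eq (hn : T.IsFaceNormal n) {β : Finset E3 → ℝ}
    (hβ : ∀ K ∈ T.cells, 0 < β K) (u : Finset E3 → E3 → E3) {θ : ℝ} (hθ : θ = 0 ∨ θ = 1)
    {K F : Finset E3} (hK : K ∈ T.cells) (hF : F ∈ facesOf K) :
    ∃ δ : ℝ, (√(β K))⁻¹ * |δ| ≤ (√(T.betaFace n β F))⁻¹ ∧
      ∀ x, inner ℝ (T.tauFace θ n β u F x) (n F) =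
        inner ℝ (tau β u K x) (n F) + δ * T.normalJump n β u F x := by
  have hsK : 0 < √(β K) := Real.sqrt_pos.2 (hβ K hK)
  -- The factor `√β_K` cancels, leaving `1 / (√β_K + √β_L)`, which is symmetric in the two cells.
  have hbound : ∀ L ∈ T.cells, (√(β K))⁻¹ * |√(β K) / (√(β K) + √(β L))| ≤
      (√((β K + β L) / 2))⁻¹ := by
    intro L hL
    have hsL : 0 < √(β L) := Real.sqrt_pos.2 (hβ L hL)
    have hpos : 0 < √((β K + β L) / 2) :=
      Real.sqrt_pos.2 (by linarith [hβ K hK, hβ L hL])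
    rw [abs_of_pos (by positivity), ← mul_div_assoc, inv_mul_cancel₀ hsK.ne', one_div]
    exact inv_anti₀ hpos (sqrt_half_le (hβ K hK).le (hβ L hL).le)
  rcases isMinus_or_isPlus hn hK hF with hmi | hpl
  · by_cases hp : ∃ L, T.IsPlus n F L
    · obtain ⟨L, hL⟩ := hp
      have hsL : 0 < √(β L) := Real.sqrt_pos.2 (hβ L hL.1)
      refine ⟨-(√(β K) / (√(β K) + √(β L))), ?_, fun x => ?_⟩
      · rw [abs_neg, betaFace, minusVal_eq hn β hmi, plusVal_eq hn β hL]
        exact hbound L hL.1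
      · have hk : T.kappaMinus θ n β F = √(β L) / (√(β K) + √(β L)) := by
          rw [kappaMinus, if_pos ⟨L, hL⟩, minusVal_eq hn β hmi, plusVal_eq hn β hL]
        rw [tauFace, normalJump, kappaPlus, hk, minusVal_eq hn _ hmi, plusVal_eq hn _ hL,
          inner_add_left, real_inner_smul_left, real_inner_smul_left]
        field_simp
        ring
    -- On a boundary face the exterior trace is zero, so the jump is the normal flux of `K` itself,
    -- and `β_F` is half of `β K`.
    · refine ⟨-(1 - θ), ?_, fun x => ?_⟩
      · rw [abs_neg, betaFace, minusVal_eq hn β hmi, plusVal_eq_zero β hp]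
        have h1 : |1 - θ| ≤ 1 := by rcases hθ with rfl | rfl <;> norm_num
        have hpos : 0 < √((β K + 0) / 2) := Real.sqrt_pos.2 (by linarith [hβ K hK])
        calc (√(β K))⁻¹ * |1 - θ| ≤ (√(β K))⁻¹ := mul_le_of_le_one_right (by positivity) h1
          _ ≤ _ := inv_anti₀ hpos (Real.sqrt_le_sqrt (by linarith [hβ K hK]))
      · have hk : T.kappaMinus θ n β F = θ := by rw [kappaMinus, if_neg hp]
        rw [tauFace, normalJump, kappaPlus, hk, minusVal_eq hn _ hmi, plusVal_eq_zero _ hp,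
          inner_add_left, real_inner_smul_left, real_inner_smul_left, Pi.zero_apply,
          inner_zero_left]
        ring
  · obtain ⟨L, hL⟩ := (hn K hK F hF).2.2
    have hsL : 0 < √(β L) := Real.sqrt_pos.2 (hβ L hL.1)
    refine ⟨√(β K) / (√(β K) + √(β L)), ?_, fun x => ?_⟩
    · rw [betaFace, minusVal_eq hn β hL, plusVal_eq hn β hpl, add_comm (β L)]
      exact hbound L hL.1
    · have hk : T.kappaMinus θ n β F = √(β K) / (√(β K) + √(β L)) := by
        rw [kappaMinus, if_pos ⟨K, hpl⟩, minusVal_eq hn β hL, plusVal_eq hn β hpl,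
          add_comm (√(β L))]
      rw [tauFace, normalJump, kappaPlus, hk, minusVal_eq hn _ hL, plusVal_eq hn _ hpl,
        inner_add_left, real_inner_smul_left, real_inner_smul_left]
      field_simp
      ring

end TetMesh

/-! ### Bounds for norms, basis functions and degrees of freedom. -/

theorem exists_affineMap_eq_add_cross (a b : E3) :
    ∃ A : E3 →ᵃ[ℝ] E3, ∀ x, A x = a + cross b x := by
  let L : E3 →ₗ[ℝ] E3 := (WithLp.linearEquiv 2 ℝ (Fin 3 → ℝ)).symm.toLinearMap ∘ₗ
    crossProduct b.ofLp ∘ₗ (WithLp.linearEquiv 2 ℝ (Fin 3 → ℝ)).toLinearMap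
  exact ⟨AffineMap.const ℝ E3 a + L.toAffineMap, fun x => rfl⟩

theorem l2Norm_const_mul (m : Measure E3) (S : Set E3) (c : ℝ) (f : E3 → ℝ) :
    l2Norm m S (fun x => c * f x) = |c| * l2Norm m S f := by
  have h : (fun x => c * f x) = c • f := rfl
  rw [l2Norm, l2Norm, h, eLpNorm_const_smul, ENNReal.toReal_mul, toReal_enorm, Real.norm_eq_abs]

theorem l2Norm_le_of_bound {V : Type*} [NormedAddCommGroup V] {S : Set E3} (hS : IsCompact S)
    {f : E3 → V} {C : ℝ} (hC : 0 ≤ C) (h : ∀ x ∈ S, ‖f x‖ ≤ C) :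
    l2Norm volume S f ≤ C * √(volume.real S) := by
  have h1 := eLpNorm_le_of_ae_bound (p := 2)
    (ae_restrict_of_forall_mem (μ := (volume : Measure E3)) hS.measurableSet h)
  rw [Measure.restrict_apply_univ] at h1
  have h2 := ENNReal.toReal_mono (ENNReal.mul_ne_top
    (ENNReal.rpow_ne_top_of_nonneg (by positivity) hS.measure_ne_top) ENNReal.ofReal_ne_top) h1
  rw [ENNReal.toReal_mul, ← ENNReal.toReal_rpow, ENNReal.toReal_ofReal hC] at h2
  have h3 : (ENNReal.toReal 2)⁻¹ = 1 / 2 := by norm_num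
  rw [h3, mul_comm] at h2
  rw [Real.sqrt_eq_rpow]
  exact h2

open Classical in
-- An edge is at most the diameter, which is at most `σ` times the inscribed diameter `2 * r`, and
-- `2 * r` is at most the height over the face. So each of the three terms is at most `9 * σ`.
theorem norm_bdmBasis_le {K : Finset E3} (hc : K.card = 4)
    (hK : AffineIndependent ℝ ((↑) : K → E3)) {i m : E3} (hi : i ∈ K) {σ r : ℝ} (hr : 0 < r)
    (hσ : 0 ≤ σ) (hm : ∀ w ∈ K, w ≠ i → 2 * r ≤ |inner ℝ m (w - i)|)
    (hdiam : Metric.diam (hull K) ≤ σ * (2 * r)) {x : E3} (hx : x ∈ hull K) (z : E3) :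
    ‖bdmBasis m K (K.erase i) z x‖ ≤ 27 * σ := by
  rw [bdmBasis, oppVertex_erase hi]
  have hterm : ∀ w ∈ K.erase i, ‖((if w = z then (9 : ℝ) else -3) * baryCoord K w x /
      inner ℝ m (edgeTangent i w)) • edgeTangent i w‖ ≤ 9 * σ := by
    intro w hw
    obtain ⟨hwi, hwK⟩ := Finset.mem_erase.1 hw
    have h2 := hm w hwK hwi
    have hd : 0 < |inner ℝ m (w - i)| := by linarith
    rw [edgeTangent_div _ m hwi, norm_smul, Real.norm_eq_abs, abs_div, abs_mul]
    have h9 : |(if w = z then (9 : ℝ) else -3)| ≤ 9 := by split_ifs <;> norm_num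
    have hb := abs_baryCoord_le_one hK hx hwK
    have hn : ‖w - i‖ ≤ σ * |inner ℝ m (w - i)| :=
      ((norm_sub_le_diam_hull hwK hi).trans hdiam).trans (mul_le_mul_of_nonneg_left h2 hσ)
    have h1 : |(if w = z then (9 : ℝ) else -3)| * |baryCoord K w x| ≤ 9 := by
      calc _ ≤ 9 * 1 := mul_le_mul h9 hb (abs_nonneg _) (by norm_num)
        _ = 9 := by norm_num
    calc _ ≤ 9 / |inner ℝ m (w - i)| * (σ * |inner ℝ m (w - i)|) :=
          mul_le_mul (by gcongr) hn (norm_nonneg _) (by positivity)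
      _ = 9 * σ := by field_simp
  refine (norm_sum_le_of_le _ hterm).trans_eq ?_
  rw [Finset.sum_const, Finset.card_erase_of_mem hi, hc]
  simp only [nsmul_eq_mul]
  norm_num
  ring

namespace TetMesh

variable {T : TetMesh} {n : Finset E3 → E3}

theorem exists_affineMap_minusVal {v : Finset E3 → E3 → E3}
    (hv : ∀ K ∈ T.cells, ∃ A : E3 →ᵃ[ℝ] E3, ∀ x, A x = v K x) (F : Finset E3) :
    ∃ A : E3 →ᵃ[ℝ] E3, ∀ x, A x = T.minusVal n v F x := by
  by_cases h : ∃ L, T.IsMinus n F L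
  · rw [minusVal, dif_pos h]
    exact hv _ h.choose_spec.1
  · rw [minusVal, dif_neg h]
    exact ⟨0, fun _ => rfl⟩

theorem exists_affineMap_plusVal {v : Finset E3 → E3 → E3}
    (hv : ∀ K ∈ T.cells, ∃ A : E3 →ᵃ[ℝ] E3, ∀ x, A x = v K x) (F : Finset E3) :
    ∃ A : E3 →ᵃ[ℝ] E3, ∀ x, A x = T.plusVal n v F x := by
  by_cases h : ∃ L, T.IsPlus n F L
  · rw [plusVal, dif_pos h]
    exact hv _ h.choose_spec.1
  · rw [plusVal, dif_neg h]
    exact ⟨0, fun _ => rfl⟩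

/-- The normal component of an affine field. -/
noncomputable def normalComponent (m : E3) (A : E3 →ᵃ[ℝ] E3) : E3 →ᵃ[ℝ] ℝ :=
  (innerSL ℝ m).toLinearMap.toAffineMap.comp A

theorem normalComponent_apply (m : E3) (A : E3 →ᵃ[ℝ] E3) (x : E3) :
    normalComponent m A x = inner ℝ (A x) m :=
  real_inner_comm (A x) m

/-- The degrees of freedom of `τ_h^* - τ_h` on a cell are bounded by the normal jumps. -/
theorem abs_recoveredDof_sub_le (hn : T.IsFaceNormal n) {β : Finset E3 → ℝ}
    (hβ : ∀ K ∈ T.cells, 0 < β K) {u : Finset E3 → E3 → E3}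
    (hu : ∀ K ∈ T.cells, ∃ A : E3 →ᵃ[ℝ] E3, ∀ x, A x = tau β u K x) {θ : ℝ}
    (hθ : θ = 0 ∨ θ = 1) {K F : Finset E3} (hK : K ∈ T.cells) (hF : F ∈ facesOf K) {z : E3}
    (hz : z ∈ F) :
    (√(β K))⁻¹ * |T.recoveredDof θ n β u F z -
      (inner ℝ (tau β u K z) (n F) + ∑ y ∈ F, inner ℝ (tau β u K y) (n F)) / 12| ≤
    (√(T.betaFace n β F))⁻¹ * (l2Norm surf (hull F) (T.normalJump n β u F) /
      √(surf.real (hull F))) := by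
  obtain ⟨hFK, hF3⟩ := Finset.mem_powersetCard.1 hF
  have hFi : AffineIndependent ℝ ((↑) : F → E3) := (T.indep K hK).mono hFK
  obtain ⟨δ, hδ, heq⟩ := exists_tauFace_sub_eq hn hβ u hθ hK hF
  obtain ⟨Am, hAm⟩ := exists_affineMap_minusVal (n := n) hu F
  obtain ⟨Ap, hAp⟩ := exists_affineMap_plusVal (n := n) hu F
  set J : E3 →ᵃ[ℝ] ℝ := normalComponent (n F) Am - normalComponent (n F) Ap with hJdef
  have hJ : ∀ x, J x = T.normalJump n β u F x := fun x => by
    rw [hJdef, normalJump, ← hAm, ← hAp, ← normalComponent_apply, ← normalComponent_apply]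
    rfl
  set G : E3 →ᵃ[ℝ] ℝ := normalComponent (n F)
    (T.kappaMinus θ n β F • Am + T.kappaPlus θ n β F • Ap) with hGdef
  have hG : ∀ x, G x = inner ℝ (T.tauFace θ n β u F x) (n F) := fun x => by
    rw [hGdef, normalComponent_apply, tauFace, ← hAm, ← hAp]
    rfl
  have hdof : T.recoveredDof θ n β u F z = (G z + ∑ y ∈ F, G y) / 12 := by
    rw [recoveredDof, ← average_affine_mul_baryCoord hF3 hFi G hz]
    simp_rw [hG]
  -- The nodal combination subtracted here is the moment of the normal flux of `K`, so the
  -- difference is `δ` times the moment of the jump.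
  have hdiff : T.recoveredDof θ n β u F z -
      (inner ℝ (tau β u K z) (n F) + ∑ y ∈ F, inner ℝ (tau β u K y) (n F)) / 12 =
      δ * ((J z + ∑ y ∈ F, J y) / 12) := by
    rw [hdof]
    simp_rw [hG, heq, hJ]
    rw [Finset.sum_add_distrib, ← Finset.mul_sum]
    ring
  have hJc : Continuous J := J.continuous_of_finiteDimensional
  have hJfun : (J : E3 → ℝ) = T.normalJump n β u F := funext hJ
  have hcs := abs_integral_mul_baryCoord_le hF3 hFi hJc hz
  have hJbound : |(J z + ∑ y ∈ F, J y) / 12| ≤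
      l2Norm surf (hull F) (T.normalJump n β u F) / √(surf.real (hull F)) := by
    rw [← average_affine_mul_baryCoord hF3 hFi J hz, ← hJfun, abs_mul,
      abs_of_nonneg (inv_nonneg.2 measureReal_nonneg)]
    refine (mul_le_mul_of_nonneg_left hcs (inv_nonneg.2 measureReal_nonneg)).trans_eq ?_
    rw [mul_left_comm, div_eq_mul_inv, ← div_eq_inv_mul, Real.sqrt_div_self', one_div]
  rw [hdiff, abs_mul, ← mul_assoc]
  exact mul_le_mul hδ hJbound (abs_nonneg _) (inv_nonneg.2 (Real.sqrt_nonneg _))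

end TetMesh

/-! ### Scaling and the final estimate. -/

/-- The ratio of the volume of a cell and the area of a face, bounded by shape regularity. -/
theorem sqrt_volume_div_le {V A h r D σ v₂ v₃ : ℝ} (hσ : 0 ≤ σ) (hr : 0 < r) (hv₂ : 0 < v₂)
    (hv₃ : 0 ≤ v₃) (hD : 0 ≤ D) (hV : V ≤ D ^ 3 * v₃) (hDr : D ≤ σ * (2 * r))
    (hA : r ^ 2 * v₂ ≤ A) (hh : 2 * r ≤ h) :
    √V / √A ≤ √(4 * σ ^ 3 * v₃ / v₂) * √h := by
  have hA0 : 0 < A := lt_of_lt_of_le (by positivity) hA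
  rw [← Real.sqrt_div' _ hA0.le, ← Real.sqrt_mul (by positivity)]
  refine Real.sqrt_le_sqrt ((div_le_iff₀ hA0).2 ?_)
  have hh0 : 0 ≤ h := by linarith
  calc V ≤ D ^ 3 * v₃ := hV
    _ ≤ (σ * (2 * r)) ^ 3 * v₃ := by gcongr
    -- Of the three powers of `r`, two are absorbed by the area of the face and one by its diameter.
    _ = 4 * σ ^ 3 * v₃ / v₂ * (2 * r) * (r ^ 2 * v₂) := by field_simp; ring
    _ ≤ 4 * σ ^ 3 * v₃ / v₂ * h * A := by gcongr

namespace TetMesh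

variable {T : TetMesh} {n : Finset E3 → E3}

open Classical in
theorem eta0_le (hn : T.IsFaceNormal n) {σ : ℝ} (hT : T.ShapeRegular σ) {β : Finset E3 → ℝ}
    (hβ : ∀ K ∈ T.cells, 0 < β K) {u : Finset E3 → E3 → E3}
    (hu : ∀ K ∈ T.cells, ∃ a b : E3, ∀ x, u K x = a + cross b x) {θ : ℝ}
    (hθ : θ = 0 ∨ θ = 1) {K : Finset E3} (hK : K ∈ T.cells) :
    T.eta0 θ n β u K ≤ 81 * |σ| * √(4 * |σ| ^ 3 * volume.real (Metric.ball (0 : E3) 1) /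
      volume.real (Metric.ball (0 : EuclideanSpace ℝ (Fin 2)) 1)) *
        ∑ F ∈ facesOf K, T.faceJumpTerm n β u F := by
  have hc := T.card_eq K hK
  have hind := T.indep K hK
  obtain ⟨p, r, hr, hball, hdiam⟩ := hT K hK
  -- Passing to `|σ|` makes the constant nonnegative for every real `σ`.
  replace hdiam : Metric.diam (hull K) ≤ |σ| * (2 * r) :=
    hdiam.trans (mul_le_mul_of_nonneg_right (le_abs_self σ) (by linarith))
  have hm := hn.isNormalFamily hK
  have hconst : ∀ i ∈ K, ∀ w ∈ K, w ≠ i → ∀ y ∈ K, y ≠ i →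
      inner ℝ (n (K.erase i)) (y - i) = inner ℝ (n (K.erase i)) (w - i) := by
    intro i hi w hw hwi y hy hyi
    rw [← sub_add_sub_cancel y w i, inner_add_right, hm.perp i hi y hy w hw hyi hwi, zero_add]
  have hnorm : ∀ i ∈ K, ‖n (K.erase i)‖ = 1 := fun i hi =>
    (hn K hK _ (erase_mem_facesOf hc hi)).1
  have hheight : ∀ i ∈ K, ∀ w ∈ K, w ≠ i → 2 * r ≤ |inner ℝ (n (K.erase i)) (w - i)| :=
    fun i hi w hw hwi => two_mul_radius_le_height hi (hnorm i hi) (hconst i hi w hw hwi) hr.le hball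
  have haff : ∀ L ∈ T.cells, ∃ A : E3 →ᵃ[ℝ] E3, ∀ x, A x = tau β u L x := by
    intro L hL
    obtain ⟨a, b, hab⟩ := hu L hL
    obtain ⟨A, hA⟩ := exists_affineMap_eq_add_cross a b
    exact ⟨β L • A, fun x => by rw [tau, hab, ← hA]; rfl⟩
  have hface : ∀ F ∈ facesOf K, √(volume.real (hull K)) / √(surf.real (hull F)) ≤
      √(4 * |σ| ^ 3 * volume.real (Metric.ball (0 : E3) 1) /
        volume.real (Metric.ball (0 : EuclideanSpace ℝ (Fin 2)) 1)) *
          √(Metric.diam (hull F)) := by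
    intro F hF
    obtain ⟨i, hi, rfl⟩ := exists_erase_of_mem_facesOf hc hF
    obtain ⟨j, k, l, hjk, -, -, hjkl⟩ := Finset.card_eq_three.1 (Finset.mem_powersetCard.1 hF).2
    have hj : j ∈ K.erase i := by simp [hjkl]
    have hk : k ∈ K.erase i := by simp [hjkl]
    have hj' := Finset.mem_of_mem_erase hj
    have hk' := Finset.mem_of_mem_erase hk
    have hji := Finset.ne_of_mem_erase hj
    refine sqrt_volume_div_le (abs_nonneg σ) hr ?_ measureReal_nonneg Metric.diam_nonneg
      (volume_real_hull_le ⟨i, hi⟩) hdiam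
      (le_surf_real_face hc hi (hnorm i hi) (hconst i hi j hj' hji) hr hball) ?_
    · exact ENNReal.toReal_pos (Metric.measure_ball_pos _ _ one_pos).ne' measure_ball_lt_top.ne
    -- The edge `jk` of `F` is at least as long as the height of `K` from `j`, measured with the
    -- normal of the face opposite to `j`.
    · calc 2 * r ≤ |inner ℝ (n (K.erase j)) (k - j)| := hheight j hj' k hk' hjk.symm
        _ ≤ ‖n (K.erase j)‖ * ‖k - j‖ := abs_real_inner_le_norm _ _
        _ = ‖k - j‖ := by rw [hnorm j hj', one_mul]
        _ ≤ _ := norm_sub_le_diam_hull hk hj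
  obtain ⟨A, hA⟩ := haff K hK
  have hb : 0 < √(β K) := Real.sqrt_pos.2 (hβ K hK)
  set e : Finset E3 → ℝ := fun F => (√(T.betaFace n β F))⁻¹ *
    (l2Norm surf (hull F) (T.normalJump n β u F) / √(surf.real (hull F))) with he
  have hl2 : ∀ F, 0 ≤ l2Norm surf (hull F) (T.normalJump n β u F) := fun F =>
    ENNReal.toReal_nonneg
  have he0 : ∀ F, 0 ≤ e F := fun F => mul_nonneg (inv_nonneg.2 (Real.sqrt_nonneg _))
    (div_nonneg (hl2 F) (Real.sqrt_nonneg _))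
  -- `81` is `27` from the bound of a basis function times the three vertices of a face.
  have hpt : ∀ x ∈ hull K, ‖(√(β K))⁻¹ • T.tauStar θ n β u K x - √(β K) • u K x‖ ≤
      ∑ F ∈ facesOf K, 81 * |σ| * e F := by
    intro x hx
    have h1 : √(β K) • u K x = (√(β K))⁻¹ • A x := by
      rw [hA, tau, smul_smul, ← div_eq_inv_mul, Real.div_sqrt]
    rw [h1, ← smul_sub, ← bdm_reproduces_affine hc hind hm A x, tauStar, ← Finset.sum_sub_distrib,
      Finset.smul_sum]
    refine norm_sum_le_of_le _ fun F hF => ?_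
    rw [← Finset.sum_sub_distrib, Finset.smul_sum]
    have hterm : ∀ z ∈ F, ‖(√(β K))⁻¹ • (T.recoveredDof θ n β u F z • bdmBasis (n F) K F z x -
        ((inner ℝ (A z) (n F) + ∑ y ∈ F, inner ℝ (A y) (n F)) / 12) • bdmBasis (n F) K F z x)‖ ≤
        27 * |σ| * e F := by
      intro z hz
      have hbdm : ‖bdmBasis (n F) K F z x‖ ≤ 27 * |σ| := by
        obtain ⟨i, hi, rfl⟩ := exists_erase_of_mem_facesOf hc hF
        exact norm_bdmBasis_le hc hind hi hr (abs_nonneg σ) (hheight i hi) hdiam hx z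
      have hd := abs_recoveredDof_sub_le hn hβ haff hθ hK hF hz
      simp_rw [← hA] at hd
      rw [← sub_smul, smul_smul, norm_smul, norm_mul, norm_inv, Real.norm_of_nonneg hb.le,
        Real.norm_eq_abs, mul_comm (27 * |σ|)]
      exact mul_le_mul hd hbdm (norm_nonneg _) (he0 F)
    refine (norm_sum_le_of_le _ hterm).trans_eq ?_
    rw [Finset.sum_const, (Finset.mem_powersetCard.1 hF).2]
    simp only [nsmul_eq_mul, Nat.cast_ofNat]
    ring
  have hmain := l2Norm_le_of_bound (isCompact_hull K)
    (Finset.sum_nonneg fun F _ => mul_nonneg (by positivity) (he0 F)) hpt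
  refine hmain.trans ?_
  rw [Finset.sum_mul, Finset.mul_sum]
  refine Finset.sum_le_sum fun F hF => ?_
  rw [faceJumpTerm, l2Norm_const_mul, abs_of_nonneg (inv_nonneg.2 (Real.sqrt_nonneg _))]
  have h2 : 0 ≤ (√(T.betaFace n β F))⁻¹ * l2Norm surf (hull F) (T.normalJump n β u F) :=
    mul_nonneg (inv_nonneg.2 (Real.sqrt_nonneg _)) (hl2 F)
  calc 81 * |σ| * e F * √(volume.real (hull K))
      = 81 * |σ| * (√(volume.real (hull K)) / √(surf.real (hull F)) *
          ((√(T.betaFace n β F))⁻¹ * l2Norm surf (hull F) (T.normalJump n β u F))) := by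
        rw [he]; ring
    _ ≤ _ := mul_le_mul_of_nonneg_left (mul_le_mul_of_nonneg_right (hface F hF) h2)
        (by positivity)
    _ = _ := by ring

end TetMesh

theorem lemma4p12 (σ : ℝ) :
    ∃ c : ℝ, 0 < c ∧
      ∀ T : TetMesh, T.ShapeRegular σ →
      ∀ n : Finset E3 → E3, T.IsFaceNormal n →
      ∀ β : Finset E3 → ℝ, (∀ K ∈ T.cells, 0 < β K) →
      ∀ u : Finset E3 → E3 → E3, T.MemND0 u →
      ∀ θ : ℝ, (θ = 0 ∨ θ = 1) →
      ∀ K ∈ T.cells,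
        c * T.eta0 θ n β u K ≤ ∑ F ∈ facesOf K, T.faceJumpTerm n β u F := by
  set M := 81 * |σ| * √(4 * |σ| ^ 3 * volume.real (Metric.ball (0 : E3) 1) /
    volume.real (Metric.ball (0 : EuclideanSpace ℝ (Fin 2)) 1)) with hM
  have hM0 : 0 ≤ M := by positivity
  -- `M` vanishes for `σ = 0`; adding `1` keeps the constant positive and finite.
  refine ⟨(M + 1)⁻¹, by positivity, fun T hT n hn β hβ u hu θ hθ K hK => ?_⟩
  have h := T.eta0_le hn hT hβ hu.1 hθ hK
  have hS : 0 ≤ ∑ F ∈ facesOf K, T.faceJumpTerm n β u F :=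
    Finset.sum_nonneg fun F _ => mul_nonneg (Real.sqrt_nonneg _) ENNReal.toReal_nonneg
  rw [inv_mul_le_iff₀ (by positivity)]
  linarith
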